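/- Let $A\in\mathbb R^{n\times n}$, $B\in\mathbb R^{n\times m}$, $C\in\mathbb R^{p\times n}$, and let $R\in\mathbb R^{m\times m}$ be symmetric positive definite. Suppose that $(A,B)$ is controllable, i.e. $[B,AB,\dots,A^{n-1}B]$ has rank $n$, and that $(A,C)$ is observable, i.e. the matrix obtained by stacking $C,CA,\dots,CA^{n-1}$ has rank $n$. Then the continuous-time algebraic Riccati equation $$A^\top P+PA-PBR^{-1}B^\top P+C^\top C=0$$ has a unique symmetric positive definite solution $P$. Moreover, let $\mathbb S^n_+$ be the cone of real symmetric positive semidefinite $n\times n$ matrices with the order $X\preceq Y\iff Y-X\in\mathbb S^n_+$, and, for $X,Y\in\mathbb S^n_+\setminus\{0\}$, let $d_{\mathcal H}(X,Y)=\ln\frac{M(X/Y)}{m(X/Y)}\in[0,\infty]$ be its Hilbert metric, where $M(X/Y)=\inf\{\lambda: X\preceq\lambda Y\}$ (with $\inf\emptyset=\infty$) and $m(X/Y)=\sup\{\lambda:\lambda Y\preceq X\}$. For $\alpha>0$ put $$F_\alpha(X)=\alpha A^\top X+\alpha XA-\frac1{\operatorname{tr}(X)}XBR^{-1}B^\top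 X+\alpha^2\operatorname{tr}(X)\,C^\top C .$$ Then, if $n\ge 1$, there is an $\alpha>0$ such that: 1. $F_\alpha(P)=0$; and whenever $X\in\mathbb S^n_+\setminus\{0\}$ and $\mu\in\mathbb R$ satisfy $F_\alpha(X)=\mu X$, one has $\mu=0$ and $P=\frac{X}{\alpha\operatorname{tr}(X)}$; 2. for every $P_0\in\mathbb S^n_+\setminus\{0\}$ the differential equation $\dot Q=F_\alpha(Q)$, $Q(0)=P_0$, has exactly one solution $Q$ on $[0,\infty)$ (with $\operatorname{tr}Q(t)\neq0$ throughout); it satisfies $Q(t)\in\mathbb S^n_+\setminus\{0\}$ for all $t\ge0$, $Q(t)$ is positive definite for all $t>0$, and $$d_{\mathcal H}(Q(t),P)\to0\quad\text{as }t\to\infty .$$ -/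

import Mathlib

open Filter Topology Matrix
open scoped ENNReal NNReal

noncomputable section

/-- The observability matrix `col(C, C A, …, C A^(n-1))`; row `(k, i)` is row `i` of `C A^k`. -/
def observabilityMatrix {n p : ℕ} (A : Matrix (Fin n) (Fin n) ℝ) (C : Matrix (Fin p) (Fin n) ℝ) :
    Matrix (Fin n × Fin p) (Fin n) ℝ :=
  Matrix.of fun r j => (C * A ^ (r.1 : ℕ)) r.2 j

/-- The controllability matrix `[B, A B, …, A^(n-1) B]`; column `(k, j)` is column `j` of
`A^k B`. -/
def controllabilityMatrix {n m : ℕ} (A : Matrix (Fin n) (Fin n) ℝ) (B : Matrix (Fin n) (Fin m) ℝ) :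
    Matrix (Fin n) (Fin n × Fin m) ℝ :=
  Matrix.of fun i c => (A ^ (c.1 : ℕ) * B) i c.2

/-- `(A, C)` is observable. -/
def IsObservable {n p : ℕ} (A : Matrix (Fin n) (Fin n) ℝ) (C : Matrix (Fin p) (Fin n) ℝ) : Prop :=
  (observabilityMatrix A C).rank = n

/-- `(A, B)` is controllable. -/
def IsControllable {n m : ℕ} (A : Matrix (Fin n) (Fin n) ℝ) (B : Matrix (Fin n) (Fin m) ℝ) : Prop :=
  (controllabilityMatrix A B).rank = n

/-- `P` solves the continuous-time algebraic Riccati equation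
`Aᵀ P + P A - P B R⁻¹ Bᵀ P + Cᵀ C = 0`. -/
def SolvesCARE {n m p : ℕ} (A : Matrix (Fin n) (Fin n) ℝ) (B : Matrix (Fin n) (Fin m) ℝ)
    (C : Matrix (Fin p) (Fin n) ℝ) (R : Matrix (Fin m) (Fin m) ℝ)
    (P : Matrix (Fin n) (Fin n) ℝ) : Prop :=
  Aᵀ * P + P * A - P * B * R⁻¹ * Bᵀ * P + Cᵀ * C = 0

/-- The homogenized Riccati vector field
`α Aᵀ P + α P A - (1 / tr P) P B R⁻¹ Bᵀ P + α² (tr P) Cᵀ C`.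
It is only used at matrices with nonzero trace. -/
def homogenizedField {n m p : ℕ} (A : Matrix (Fin n) (Fin n) ℝ) (B : Matrix (Fin n) (Fin m) ℝ)
    (C : Matrix (Fin p) (Fin n) ℝ) (R : Matrix (Fin m) (Fin m) ℝ) (α : ℝ)
    (P : Matrix (Fin n) (Fin n) ℝ) : Matrix (Fin n) (Fin n) ℝ :=
  α • (Aᵀ * P) + α • (P * A) - (1 / P.trace) • (P * B * R⁻¹ * Bᵀ * P)
    + (α ^ 2 * P.trace) • (Cᵀ * C)

/-- `P` is a solution on `[0, ∞)` of the ODE `Ṗ = homogenizedField A B C R α P`, inside the set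
`tr P ≠ 0` where its right-hand side is defined, with `P 0 = P₀`. The derivative is taken entry by
entry (one-sided at time `0`); values of `P` at negative times play no role. -/
structure IsTrajectory {n m p : ℕ} (A : Matrix (Fin n) (Fin n) ℝ) (B : Matrix (Fin n) (Fin m) ℝ)
    (C : Matrix (Fin p) (Fin n) ℝ) (R : Matrix (Fin m) (Fin m) ℝ) (α : ℝ)
    (P₀ : Matrix (Fin n) (Fin n) ℝ) (P : ℝ → Matrix (Fin n) (Fin n) ℝ) : Prop where
  initial : P 0 = P₀
  trace_ne_zero : ∀ t : ℝ, 0 ≤ t → (P t).trace ≠ 0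
  hasDeriv : ∀ t : ℝ, 0 ≤ t → ∀ i j : Fin n,
    HasDerivWithinAt (fun s => P s i j) (homogenizedField A B C R α (P t) i j) (Set.Ici 0) t

/-- The cone of real symmetric positive semidefinite `n × n` matrices. -/
def psdCone (n : ℕ) : Set (Matrix (Fin n) (Fin n) ℝ) := {X | X.PosSemidef}

/-- `M(x/y) = inf {l | x ≤ l y}` for the order of the cone `K`, with value `∞` if there is no such
`l`. For `x, y ∈ K \ {0}` only `l ≥ 0` can satisfy `x ≤ l y`. -/
def hilbertM {V : Type*} [AddCommGroup V] [Module ℝ V] (K : Set V) (x y : V) : ℝ≥0∞ :=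
  ⨅ (l : ℝ≥0) (_ : (l : ℝ) • y - x ∈ K), (l : ℝ≥0∞)

/-- `m(x/y) = sup {l | l y ≤ x}` for the order of the cone `K`. For `x ∈ K` the value `l = 0` is
admissible, so that the supremum may be taken over `l ≥ 0`. -/
def hilbertm {V : Type*} [AddCommGroup V] [Module ℝ V] (K : Set V) (x y : V) : ℝ≥0∞ :=
  ⨆ (l : ℝ≥0) (_ : x - (l : ℝ) • y ∈ K), (l : ℝ≥0∞)

/-- The Hilbert metric `ln (M(x/y) / m(x/y))` of the cone `K`, for `x, y ∈ K \ {0}`; it is `∞` when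
`m(x/y) = 0` or `M(x/y) = ∞`. -/
def hilbertDist {V : Type*} [AddCommGroup V] [Module ℝ V] (K : Set V) (x y : V) : EReal :=
  ENNReal.log (hilbertM K x y / hilbertm K x y)

end

/-! Put S = B R⁻¹ Bᵀ and W = Cᵀ C. Both are positive semidefinite, and the rank conditions say that
a vector killed by all S (Aᵀ)^k, or by all W A^k, is zero. Nothing else about B, C, R is used.

Riccati equation. Controllability yields a strict supersolution Z, which dominates every symmetric
subsolution, so the semidefinite subsolutions form a compact set. One of maximal trace is a
solution: a nonzero residual would allow a correction, found from a Lyapunov equation, that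
increases the trace. Uniqueness comes from a contact argument used several times: take the extremal
c with P ≤ cQ, compare the two equations on the kernel of cQ - P, and deduce that this kernel is
A-invariant and lies in ker W. Observability makes it trivial.

Homogenized flow. For α = 1 / tr P the field at P is α times the Riccati operator, hence zero. The
field F is homogeneous of degree one, so every cP with c > 0 is an equilibrium. Because XSX / tr X
is a perspective function, jointly convex in X and tr X, F is quasimonotone
(`homField_quasimonotone`) and superadditive (`homField_superadditive`). Quasimonotonicity makes the
flow order preserving (`SolvesOn.posSemidef_sub`). By superadditivity the difference of two ordered
solutions is a supersolution, and observability makes a nonzero one positive definite at once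
(`posDef_of_supersolution`), so the order preservation is strong.

Convergence. The largest a with aP ≤ Q(t) never decreases and is bounded; let c be its supremum over
integer times and X a limit point of Q at these times. Then cP ≤ X. If X ≠ cP, the flow lifts X
above (c + δ/2)P within unit time, and by continuous dependence it also lifts Q(t) for some late t,
against the choice of c. So X = cP, and invariant order intervals around cP trap the trajectory,
which is convergence in the Hilbert metric. -/

theorem Matrix.PosSemidef.transpose_eq {ι : Type*} {M : Matrix ι ι ℝ} (hM : M.PosSemidef) :
    Mᵀ = M := by
  simpa [conjTranspose_eq_transpose_of_trivial] using hM.1.eq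

/-! ### Quadratic forms, extremal ratios and Lyapunov equations -/

section QuadraticForms

variable {ι : Type*} [Fintype ι]

theorem dot_transpose_mulVec (M : Matrix ι ι ℝ) (v w : ι → ℝ) :
    v ⬝ᵥ Mᵀ *ᵥ w = (M *ᵥ v) ⬝ᵥ w := by
  rw [dotProduct_mulVec, vecMul_transpose]

theorem dotProduct_mulVec_of_symm {M : Matrix ι ι ℝ} (hM : Mᵀ = M) (v w : ι → ℝ) :
    v ⬝ᵥ M *ᵥ w = (M *ᵥ v) ⬝ᵥ w := by
  rw [← dot_transpose_mulVec, hM]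

theorem Matrix.PosSemidef.quad_nonneg {M : Matrix ι ι ℝ} (hM : M.PosSemidef) (v : ι → ℝ) :
    0 ≤ v ⬝ᵥ M *ᵥ v := by
  simpa using hM.dotProduct_mulVec_nonneg v

theorem Matrix.PosDef.quad_pos {M : Matrix ι ι ℝ} (hM : M.PosDef) {v : ι → ℝ} (hv : v ≠ 0) :
    0 < v ⬝ᵥ M *ᵥ v := by
  simpa using hM.dotProduct_mulVec_pos hv

theorem Matrix.PosSemidef.mulVec_eq_zero {M : Matrix ι ι ℝ} (hM : M.PosSemidef) {v : ι → ℝ}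
    (hv : v ⬝ᵥ M *ᵥ v = 0) : M *ᵥ v = 0 :=
  (hM.dotProduct_mulVec_zero_iff v).1 (by simpa using hv)

theorem posSemidef_of_quad {M : Matrix ι ι ℝ} (hM : Mᵀ = M) (h : ∀ v, 0 ≤ v ⬝ᵥ M *ᵥ v) :
    M.PosSemidef :=
  .of_dotProduct_mulVec_nonneg (by simpa [IsHermitian] using hM) (by simpa using h)

theorem posDef_of_quad {M : Matrix ι ι ℝ} (hM : Mᵀ = M) (h : ∀ v ≠ 0, 0 < v ⬝ᵥ M *ᵥ v) :
    M.PosDef :=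
  .of_dotProduct_mulVec_pos (by simpa [IsHermitian] using hM) (by simpa using h)

theorem Matrix.PosSemidef.posDef_of_ker {M : Matrix ι ι ℝ} (hM : M.PosSemidef)
    (h : ∀ v, M *ᵥ v = 0 → v = 0) : M.PosDef :=
  posDef_of_quad hM.transpose_eq fun v hv =>
    lt_of_le_of_ne (hM.quad_nonneg v) fun h0 => hv (h v (hM.mulVec_eq_zero h0.symm))

theorem dotProduct_self_pos {v : ι → ℝ} (hv : v ≠ 0) : 0 < v ⬝ᵥ v := by
  simpa using dotProduct_star_self_pos_iff.2 hv

theorem dotProduct_self_nonneg' (v : ι → ℝ) : 0 ≤ v ⬝ᵥ v :=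
  Finset.sum_nonneg fun i _ => mul_self_nonneg (v i)

theorem quad_smul (M : Matrix ι ι ℝ) (c : ℝ) (v : ι → ℝ) :
    (c • v) ⬝ᵥ M *ᵥ (c • v) = c ^ 2 * (v ⬝ᵥ M *ᵥ v) := by
  simp only [mulVec_smul, smul_dotProduct, dotProduct_smul, smul_eq_mul]; ring

theorem exists_smul_unit {v : ι → ℝ} (hv : v ≠ 0) :
    ∃ c : ℝ, ∃ w : ι → ℝ, 0 < c ∧ w ⬝ᵥ w = 1 ∧ v = c • w := by
  have h := dotProduct_self_pos hv
  have hs : √(v ⬝ᵥ v) ≠ 0 := (Real.sqrt_pos.2 h).ne'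
  refine ⟨√(v ⬝ᵥ v), (√(v ⬝ᵥ v))⁻¹ • v, Real.sqrt_pos.2 h, ?_, ?_⟩
  · simp only [smul_dotProduct, dotProduct_smul, smul_eq_mul]
    rw [← mul_assoc, ← mul_inv, Real.mul_self_sqrt h.le, inv_mul_cancel₀ h.ne']
  · rw [smul_smul, mul_inv_cancel₀ hs, one_smul]

theorem posSemidef_of_unit {M : Matrix ι ι ℝ} (hM : Mᵀ = M)
    (h : ∀ v, v ⬝ᵥ v = 1 → 0 ≤ v ⬝ᵥ M *ᵥ v) : M.PosSemidef := by
  refine posSemidef_of_quad hM fun v => ?_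
  rcases eq_or_ne v 0 with rfl | hv
  · simp
  · obtain ⟨c, w, -, hw, rfl⟩ := exists_smul_unit hv
    rw [quad_smul]
    exact mul_nonneg (sq_nonneg c) (h w hw)

theorem isCompact_unit : IsCompact {v : ι → ℝ | v ⬝ᵥ v = 1} := by
  refine Metric.isCompact_of_isClosed_isBounded
    (isClosed_eq (by simp only [dotProduct]; fun_prop) continuous_const) ?_
  refine (Metric.isBounded_iff_subset_closedBall 0).2 ⟨1, fun v hv => ?_⟩
  rw [mem_closedBall_zero_iff, pi_norm_le_iff_of_nonneg zero_le_one]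
  intro i
  have h1 : v i * v i ≤ v ⬝ᵥ v :=
    Finset.single_le_sum (f := fun i => v i * v i) (fun i _ => mul_self_nonneg _)
      (Finset.mem_univ i)
  rw [show v ⬝ᵥ v = 1 from hv] at h1
  rw [Real.norm_eq_abs]
  exact abs_le_one_iff_mul_self_le_one.2 h1

theorem continuous_quad : Continuous fun q : Matrix ι ι ℝ × (ι → ℝ) => q.2 ⬝ᵥ q.1 *ᵥ q.2 := by
  simp only [dotProduct, mulVec]
  fun_prop

theorem exists_unit [Nonempty ι] : ∃ v : ι → ℝ, v ⬝ᵥ v = 1 := by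
  classical
  obtain ⟨i⟩ := ‹Nonempty ι›
  exact ⟨Pi.single i 1, by simp⟩

/-- The largest generalized eigenvalue of a symmetric matrix relative to a positive definite one. -/
theorem exists_extremal_ratio [Nonempty ι] {Z X : Matrix ι ι ℝ} (hZ : Z.PosDef) (hX : Xᵀ = X) :
    ∃ c : ℝ, (c • Z - X).PosSemidef ∧ ∃ v ≠ 0, X *ᵥ v = c • Z *ᵥ v := by
  have hne : ∀ v : ι → ℝ, v ⬝ᵥ v = 1 → v ≠ 0 := by rintro _ h rfl; simp at h
  have hZc : Continuous fun v => v ⬝ᵥ Z *ᵥ v :=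
    continuous_quad.comp (.prodMk continuous_const continuous_id)
  have hXc : Continuous fun v => v ⬝ᵥ X *ᵥ v :=
    continuous_quad.comp (.prodMk continuous_const continuous_id)
  obtain ⟨v, hv, hmax⟩ := isCompact_unit.exists_isMaxOn (exists_unit (ι := ι))
    (f := fun v => v ⬝ᵥ X *ᵥ v / v ⬝ᵥ Z *ᵥ v)
    (hXc.continuousOn.div hZc.continuousOn fun v hv => (hZ.quad_pos (hne v hv)).ne')
  have hquad : ∀ (c : ℝ) w, w ⬝ᵥ (c • Z - X) *ᵥ w = c * (w ⬝ᵥ Z *ᵥ w) - w ⬝ᵥ X *ᵥ w := by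
    intro c w
    simp [sub_mulVec, smul_mulVec]
  have hps : ((v ⬝ᵥ X *ᵥ v / v ⬝ᵥ Z *ᵥ v) • Z - X).PosSemidef := by
    refine posSemidef_of_unit (by simp [hX, hZ.posSemidef.transpose_eq]) fun w hw => ?_
    have h1 : w ⬝ᵥ X *ᵥ w / w ⬝ᵥ Z *ᵥ w ≤ v ⬝ᵥ X *ᵥ v / v ⬝ᵥ Z *ᵥ v := hmax hw
    rw [div_le_iff₀ (hZ.quad_pos (hne w hw))] at h1
    rw [hquad]; linarith
  refine ⟨_, hps, v, hne v hv, ?_⟩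
  have := hps.mulVec_eq_zero (v := v) (by
    rw [hquad, div_mul_cancel₀ _ (hZ.quad_pos (hne v hv)).ne', sub_self])
  rw [sub_mulVec, sub_eq_zero, smul_mulVec] at this
  exact this.symm

/-- The smallest generalized eigenvalue of a symmetric matrix relative to a positive definite
one. -/
theorem exists_extremal_ratio_lower [Nonempty ι] {Z X : Matrix ι ι ℝ} (hZ : Z.PosDef)
    (hX : Xᵀ = X) :
    ∃ c : ℝ, (X - c • Z).PosSemidef ∧ ∃ v ≠ 0, X *ᵥ v = c • Z *ᵥ v := by
  obtain ⟨c, h1, v, hv, h2⟩ := exists_extremal_ratio hZ (X := -X) (by simp [hX])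
  refine ⟨-c, by convert h1 using 1; module, v, hv, ?_⟩
  rw [neg_mulVec] at h2
  rw [neg_smul, ← h2, neg_neg]

theorem Matrix.PosDef.exists_pos_smul_le {Z X : Matrix ι ι ℝ} (hX : X.PosDef) (hZ : Z.PosDef) :
    ∃ c : ℝ, 0 < c ∧ (X - c • Z).PosSemidef := by
  cases isEmpty_or_nonempty ι
  · exact ⟨1, one_pos, posSemidef_of_quad (Subsingleton.elim _ _) fun v => by simp⟩
  obtain ⟨c, h1, v, hv, h2⟩ := exists_extremal_ratio_lower hZ hX.posSemidef.transpose_eq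
  refine ⟨c, ?_, h1⟩
  have h3 := hX.quad_pos hv
  rw [h2, dotProduct_smul, smul_eq_mul] at h3
  exact pos_of_mul_pos_left h3 (hZ.quad_pos hv).le

/-- The sum of the absolute values of the entries. -/
def entrySum (M : Matrix ι ι ℝ) : ℝ := ∑ i, ∑ j, |M i j|

theorem entrySum_nonneg (M : Matrix ι ι ℝ) : 0 ≤ entrySum M :=
  Finset.sum_nonneg fun _ _ => Finset.sum_nonneg fun _ _ => abs_nonneg _

theorem continuous_entrySum : Continuous (entrySum (ι := ι)) := by
  unfold entrySum; fun_prop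

theorem abs_quad_le (M : Matrix ι ι ℝ) (v : ι → ℝ) :
    |v ⬝ᵥ M *ᵥ v| ≤ entrySum M * (v ⬝ᵥ v) := by
  have hi : ∀ i, v i * v i ≤ v ⬝ᵥ v := fun i =>
    Finset.single_le_sum (f := fun i => v i * v i) (fun i _ => mul_self_nonneg _)
      (Finset.mem_univ i)
  rw [entrySum, Finset.sum_mul]
  refine (Finset.abs_sum_le_sum_abs _ _).trans (Finset.sum_le_sum fun i _ => ?_)
  rw [mulVec, dotProduct, Finset.mul_sum, Finset.sum_mul]
  refine (Finset.abs_sum_le_sum_abs _ _).trans (Finset.sum_le_sum fun j _ => ?_)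
  rw [abs_mul, abs_mul]
  have h1 : |v i| * |v j| ≤ v ⬝ᵥ v := by
    nlinarith [hi i, hi j, sq_nonneg (|v i| - |v j|), abs_mul_abs_self (v i),
      abs_mul_abs_self (v j)]
  calc |v i| * (|M i j| * |v j|) = |M i j| * (|v i| * |v j|) := by ring
    _ ≤ _ := mul_le_mul_of_nonneg_left h1 (abs_nonneg _)

/-- Testing on e_i ± e_j gives 2|M_ij| ≤ M_ii + M_jj. On the cone the trace thus serves as a norm.
-/
theorem Matrix.PosSemidef.abs_apply_le_trace {M : Matrix ι ι ℝ} (hM : M.PosSemidef) (i j : ι) :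
    |M i j| ≤ M.trace := by
  classical
  have hd : ∀ i, M i i ≤ M.trace := fun i =>
    Finset.single_le_sum (f := fun i => M i i) (fun i _ => hM.diag_nonneg) (Finset.mem_univ i)
  have hs : M j i = M i j := congrFun (congrFun hM.transpose_eq i) j
  have h1 := hM.quad_nonneg (Pi.single i 1 + Pi.single j 1)
  have h2 := hM.quad_nonneg (Pi.single i 1 - Pi.single j 1)
  simp [mulVec_add, mulVec_sub, add_dotProduct, sub_dotProduct, hs] at h1 h2
  rw [abs_le]
  constructor <;> linarith [hd i, hd j]

theorem Matrix.PosSemidef.quad_le_trace {M : Matrix ι ι ℝ} (hM : M.PosSemidef) (v : ι → ℝ) :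
    v ⬝ᵥ M *ᵥ v ≤ (Fintype.card ι : ℝ) ^ 2 * M.trace * (v ⬝ᵥ v) := by
  refine (le_abs_self _).trans ((abs_quad_le M v).trans ?_)
  refine mul_le_mul_of_nonneg_right ?_ (dotProduct_self_nonneg' v)
  calc entrySum M ≤ ∑ _i : ι, ∑ _j : ι, M.trace :=
        Finset.sum_le_sum fun i _ => Finset.sum_le_sum fun j _ => hM.abs_apply_le_trace i j
    _ = _ := by simp; ring

/-- If 0 ≤ M ≤ b then M² ≤ bM. Testing M on b v - M v proves this without a square root. -/
theorem Matrix.PosSemidef.mulVec_dotProduct_mulVec_le {M : Matrix ι ι ℝ} (hM : M.PosSemidef)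
    (v : ι → ℝ) :
    (M *ᵥ v) ⬝ᵥ (M *ᵥ v) ≤ (Fintype.card ι : ℝ) ^ 2 * M.trace * (v ⬝ᵥ M *ᵥ v) := by
  set b := (Fintype.card ι : ℝ) ^ 2 * M.trace with hb
  have hb0 : 0 ≤ b := mul_nonneg (sq_nonneg _) hM.trace_nonneg
  have h1 := hM.quad_le_trace (M *ᵥ v)
  rw [← hb] at h1
  rcases hb0.eq_or_lt with h0 | h0
  · rcases mul_eq_zero.1 (hb.symm.trans h0.symm) with h | h
    · have : IsEmpty ι := Fintype.card_eq_zero_iff.1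
        (by exact_mod_cast pow_eq_zero_iff two_ne_zero |>.1 h)
      simp
    · rw [hM.trace_eq_zero_iff.1 h]; simp
  have h2 := hM.quad_nonneg (b • v - M *ᵥ v)
  have h3 : (b • v - M *ᵥ v) ⬝ᵥ M *ᵥ (b • v - M *ᵥ v) =
      b ^ 2 * (v ⬝ᵥ M *ᵥ v) - 2 * b * ((M *ᵥ v) ⬝ᵥ (M *ᵥ v)) + (M *ᵥ v) ⬝ᵥ M *ᵥ (M *ᵥ v) := by
    simp only [mulVec_sub, sub_dotProduct, mulVec_smul, smul_dotProduct, dotProduct_sub,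
      dotProduct_smul, smul_eq_mul, dotProduct_mulVec_of_symm hM.transpose_eq v (M *ᵥ v)]
    ring
  rw [h3] at h2
  have h4 : 0 ≤ b * (b * (v ⬝ᵥ M *ᵥ v) - (M *ᵥ v) ⬝ᵥ (M *ᵥ v)) := by nlinarith
  have := nonneg_of_mul_nonneg_right h4 h0
  linarith

/-- The quadratic Riccati term M S M is at most a multiple of tr(M) M, so it can be absorbed into
linear terms. -/
theorem Matrix.PosSemidef.quad_mulVec_le {M : Matrix ι ι ℝ} (hM : M.PosSemidef)
    (S : Matrix ι ι ℝ) (v : ι → ℝ) :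
    (M *ᵥ v) ⬝ᵥ S *ᵥ (M *ᵥ v) ≤
      entrySum S * (Fintype.card ι : ℝ) ^ 2 * M.trace * (v ⬝ᵥ M *ᵥ v) := by
  refine (le_abs_self _).trans ((abs_quad_le S _).trans ?_)
  have := mul_le_mul_of_nonneg_left (hM.mulVec_dotProduct_mulVec_le v) (entrySum_nonneg S)
  linarith

theorem isClosed_setOf_posSemidef : IsClosed {M : Matrix ι ι ℝ | M.PosSemidef} := by
  have : {M : Matrix ι ι ℝ | M.PosSemidef} =
      {M | Mᵀ = M} ∩ ⋂ v : ι → ℝ, {M | 0 ≤ v ⬝ᵥ M *ᵥ v} := by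
    ext M
    simp only [Set.mem_ofPred_eq, Set.mem_inter_iff, Set.mem_iInter]
    exact ⟨fun h => ⟨h.transpose_eq, h.quad_nonneg⟩, fun h => posSemidef_of_quad h.1 h.2⟩
  rw [this]
  refine (isClosed_eq (by fun_prop) continuous_id).inter (isClosed_iInter fun v => ?_)
  exact isClosed_le continuous_const 
    (continuous_quad.comp (.prodMk continuous_id continuous_const))

theorem Matrix.PosSemidef.trace_pos {M : Matrix ι ι ℝ} (hM : M.PosSemidef) (h : M ≠ 0) :
    0 < M.trace :=
  lt_of_le_of_ne hM.trace_nonneg fun h0 => h (hM.trace_eq_zero_iff.1 h0.symm)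

theorem Matrix.PosDef.trace_pos' [Nonempty ι] {M : Matrix ι ι ℝ} (hM : M.PosDef) :
    0 < M.trace := by
  refine hM.posSemidef.trace_pos ?_
  rintro rfl
  obtain ⟨v, hv⟩ := exists_unit (ι := ι)
  simpa using hM.quad_pos (v := v) (by rintro rfl; simp at hv)

/-- An A-invariant kernel inside ker W consists of unobservable vectors. With Aᵀ and S in place of A
and W the same lemma serves controllability. -/
theorem mulVec_eq_zero_of_invariant [DecidableEq ι] {A W M : Matrix ι ι ℝ}
    (hobs : ∀ v, (∀ k : ℕ, W *ᵥ (A ^ k *ᵥ v) = 0) → v = 0)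
    (hM : ∀ v, M *ᵥ v = 0 → W *ᵥ v = 0 ∧ M *ᵥ (A *ᵥ v) = 0) (v : ι → ℝ) (hv : M *ᵥ v = 0) :
    v = 0 := by
  have h : ∀ k : ℕ, M *ᵥ (A ^ k *ᵥ v) = 0 := by
    intro k
    induction k with
    | zero => simpa using hv
    | succ k ih => rw [pow_succ', ← mulVec_mulVec]; exact (hM _ ih).2
  exact hobs v fun k => (hM _ (h k)).1

open scoped Matrix.Norms.Operator in
/-- Solvability of a strongly damped Lyapunov equation in the semidefinite cone. -/
theorem exists_lyapunov [DecidableEq ι] (G : Matrix ι ι ℝ) :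
    ∃ l : ℝ, 0 < l ∧ ∀ D : Matrix ι ι ℝ, D.PosSemidef →
      ∃ X : Matrix ι ι ℝ, X.PosSemidef ∧ l • X - (Gᵀ * X + X * G) = D := by
  -- The two norms make the damped operator injective; the entry sum makes l exceed twice the
  -- quadratic form of G on unit vectors.
  set l : ℝ := ‖Gᵀ‖ + ‖G‖ + 2 * entrySum G + 1 with hl
  have hl0 : 0 < l := by have := entrySum_nonneg G; positivity
  refine ⟨l, hl0, fun D hD => ?_⟩
  let f : Matrix ι ι ℝ →ₗ[ℝ] Matrix ι ι ℝ :=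
    l • LinearMap.id - (LinearMap.mulLeft ℝ Gᵀ + LinearMap.mulRight ℝ G)
  have hf : ∀ X, f X = l • X - (Gᵀ * X + X * G) := fun X => by simp [f]
  have hinj : Function.Injective f := by
    rw [injective_iff_map_eq_zero]
    intro X hX
    rw [hf, sub_eq_zero] at hX
    have h1 : l * ‖X‖ ≤ (‖Gᵀ‖ + ‖G‖) * ‖X‖ := by
      have h2 := congrArg norm hX
      rw [norm_smul, Real.norm_of_nonneg hl0.le] at h2
      rw [h2]
      refine (norm_add_le _ _).trans ?_
      have h3 := norm_mul_le Gᵀ X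
      have h4 := norm_mul_le X G
      linarith
    have h5 : ‖X‖ ≤ 0 := by
      have := entrySum_nonneg G
      nlinarith [norm_nonneg X]
    exact norm_le_zero_iff.1 h5
  obtain ⟨X, hX⟩ := (LinearMap.injective_iff_surjective.1 hinj) D
  -- The transposed equation has the same right-hand side, so injectivity gives symmetry.
  have hsymm : Xᵀ = X := by
    apply hinj
    have h1 := congrArg transpose (hf X ▸ hX)
    rw [hX, ← hD.transpose_eq, ← h1, hf]
    simp [add_comm]
  refine ⟨X, ?_, hf X ▸ hX⟩
  cases isEmpty_or_nonempty ι
  · exact posSemidef_of_quad hsymm fun v => by simp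
  obtain ⟨c, hc, v, hv, hcv⟩ := exists_extremal_ratio_lower PosDef.one hsymm
  rw [one_mulVec] at hcv
  have h0 := dotProduct_self_pos hv
  -- At an eigenvector v for the least eigenvalue c, v·Dv = c (l v·v - 2 v·Gv), and the bracket is
  -- positive.
  have hc0 : 0 ≤ c := by
    by_contra hneg
    have h1 := hD.quad_nonneg v
    rw [← hX, hf] at h1
    simp only [sub_mulVec, add_mulVec, smul_mulVec, ← mulVec_mulVec, dotProduct_sub,
      dotProduct_add, dotProduct_smul, dot_transpose_mulVec, smul_eq_mul,
      dotProduct_mulVec_of_symm hsymm v (G *ᵥ v), hcv, smul_dotProduct,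
      mulVec_smul, dotProduct_comm (G *ᵥ v) v] at h1
    have h2 := abs_le.1 (abs_quad_le G v)
    have h3 : 2 * (v ⬝ᵥ G *ᵥ v) < l * (v ⬝ᵥ v) := by
      have : 0 < (l - 2 * entrySum G) * (v ⬝ᵥ v) := by
        refine mul_pos ?_ h0
        have := norm_nonneg Gᵀ
        have := norm_nonneg G
        linarith
      nlinarith
    nlinarith
  have := hc.add (PosSemidef.one.smul hc0)
  simpa using this

end QuadraticForms

/-! ### The algebraic Riccati equation -/

section Riccati

variable {ι : Type*} [Fintype ι]

/-- The algebraic Riccati operator `Aᵀ X + X A - X S X + W`. -/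
def riccati (A S W X : Matrix ι ι ℝ) : Matrix ι ι ℝ :=
  Aᵀ * X + X * A - X * S * X + W

theorem quad_riccati (A S W : Matrix ι ι ℝ) {X : Matrix ι ι ℝ} (hX : Xᵀ = X) (v : ι → ℝ) :
    v ⬝ᵥ riccati A S W X *ᵥ v =
      2 * ((X *ᵥ v) ⬝ᵥ (A *ᵥ v)) - (X *ᵥ v) ⬝ᵥ S *ᵥ (X *ᵥ v) + v ⬝ᵥ W *ᵥ v := by
  simp only [riccati, sub_mulVec, add_mulVec, ← mulVec_mulVec, dotProduct_sub, dotProduct_add,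
    dot_transpose_mulVec, dotProduct_mulVec_of_symm hX v, dotProduct_comm (A *ᵥ v)]
  ring

/-- Exact second-order expansion at X: the linear part is the Lyapunov operator of the closed loop A
- SX. -/
theorem riccati_add (A S W X Y : Matrix ι ι ℝ) (hS : Sᵀ = S) (hX : Xᵀ = X) :
    riccati A S W (X + Y) =
      riccati A S W X + ((A - S * X)ᵀ * Y + Y * (A - S * X)) - Y * S * Y := by
  simp only [riccati, transpose_sub, transpose_mul, hS, hX]
  noncomm_ring

variable [DecidableEq ι]

/-- For v in ker X the quadratic form of the equation leaves v·Wv = 0, and the equation applied to v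
then leaves XAv = 0. -/
theorem posDef_of_riccati_eq_zero {A S W X : Matrix ι ι ℝ}
    (hobs : ∀ v, (∀ k : ℕ, W *ᵥ (A ^ k *ᵥ v) = 0) → v = 0) (hW : W.PosSemidef)
    (hX : X.PosSemidef) (h : riccati A S W X = 0) : X.PosDef := by
  refine hX.posDef_of_ker (mulVec_eq_zero_of_invariant hobs fun v hv => ?_)
  have h1 := quad_riccati A S W hX.transpose_eq v
  rw [h, hv] at h1
  have h2 : W *ᵥ v = 0 := hW.mulVec_eq_zero (by simpa using h1.symm)
  refine ⟨h2, ?_⟩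
  have h3 : riccati A S W X *ᵥ v = 0 := by rw [h, zero_mulVec]
  simpa [riccati, sub_mulVec, add_mulVec, ← mulVec_mulVec, hv, h2] using h3

/-- A strict supersolution of the Riccati equation exists if the pair `(A, S)` is controllable. -/
theorem exists_riccati_supersolution {A S W : Matrix ι ι ℝ}
    (hctr : ∀ v, (∀ k : ℕ, S *ᵥ (Aᵀ ^ k *ᵥ v) = 0) → v = 0) (hS : S.PosSemidef)
    (hW : W.PosSemidef) :
    ∃ Z : Matrix ι ι ℝ, Z.PosDef ∧ ∀ v ≠ 0, v ⬝ᵥ riccati A S W Z *ᵥ v < 0 := by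
  cases isEmpty_or_nonempty ι
  · exact ⟨1, .one, fun v hv => (hv (Subsingleton.elim _ _)).elim⟩
  -- N solves l N + A N + N Aᵀ = S and acts as a controllability Gramian. Multiples of its inverse
  -- are the candidates for Z.
  obtain ⟨l, hl, hlyap⟩ := exists_lyapunov (-Aᵀ)
  obtain ⟨N, hN, hNS⟩ := hlyap S hS
  have hN' : N.PosDef := by
    refine hN.posDef_of_ker (mulVec_eq_zero_of_invariant hctr fun v hv => ?_)
    have h1 : S *ᵥ v = N *ᵥ (Aᵀ *ᵥ v) := by
      rw [← hNS]
      simp [sub_mulVec, add_mulVec, smul_mulVec, ← mulVec_mulVec, hv, neg_mulVec]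
    have h2 : S *ᵥ v = 0 := by
      refine hS.mulVec_eq_zero ?_
      rw [h1, dotProduct_mulVec_of_symm hN.transpose_eq, hv, zero_dotProduct]
    exact ⟨h2, h1 ▸ h2⟩
  have hI : N⁻¹.PosDef := hN'.inv
  have hu : IsUnit N.det := (Matrix.isUnit_iff_isUnit_det N).1 hN'.isUnit
  have hkey : Aᵀ * N⁻¹ + N⁻¹ * A = N⁻¹ * S * N⁻¹ - l • N⁻¹ := by
    have h1 : N⁻¹ * (l • N - ((-Aᵀ)ᵀ * N + N * (-Aᵀ))) * N⁻¹ = N⁻¹ * S * N⁻¹ := by rw [hNS]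
    rw [← h1]
    simp only [transpose_neg, transpose_transpose, Matrix.mul_sub, Matrix.sub_mul, Matrix.mul_add,
      Matrix.add_mul, Matrix.mul_smul, Matrix.smul_mul, nonsing_inv_mul _ hu, Matrix.neg_mul,
      Matrix.mul_neg, Matrix.one_mul]
    rw [Matrix.mul_assoc N⁻¹ (A * N), Matrix.mul_assoc A, mul_nonsing_inv _ hu, Matrix.mul_one,
      ← Matrix.mul_assoc N⁻¹ N, nonsing_inv_mul _ hu, Matrix.one_mul]
    abel
  obtain ⟨c₁, hc₁, -⟩ := exists_extremal_ratio hI hW.transpose_eq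
  -- The bound 1 ≤ c makes the coefficient c(1 - c) of N⁻¹SN⁻¹ nonpositive; c₁ < c l makes c l N⁻¹
  -- dominate W strictly.
  obtain ⟨c, hc1, hc2⟩ : ∃ c : ℝ, 1 ≤ c ∧ c₁ < c * l :=
    ⟨max 1 (c₁ / l + 1), le_max_left _ _, by
      have := le_max_right 1 (c₁ / l + 1)
      have h2 : c₁ / l < max 1 (c₁ / l + 1) := by linarith
      exact (div_lt_iff₀ hl).1 h2⟩
  refine ⟨c • N⁻¹, hI.smul (by linarith), fun v hv => ?_⟩
  have h1 : riccati A S W (c • N⁻¹) =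
      (c * (1 - c)) • (N⁻¹ * S * N⁻¹) - ((c * l) • N⁻¹ - W) := by
    have : riccati A S W (c • N⁻¹) =
        c • (Aᵀ * N⁻¹ + N⁻¹ * A) - (c * c) • (N⁻¹ * S * N⁻¹) + W := by
      simp only [riccati, Matrix.mul_smul, Matrix.smul_mul, smul_add, smul_smul]
    rw [this, hkey]
    module
  have h2 : 0 ≤ v ⬝ᵥ (N⁻¹ * S * N⁻¹) *ᵥ v := by
    rw [← mulVec_mulVec, ← mulVec_mulVec, dotProduct_mulVec_of_symm hI.posSemidef.transpose_eq]
    exact hS.quad_nonneg _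
  have h3 := hc₁.quad_nonneg v
  have h4 := hI.quad_pos hv
  rw [h1]
  simp only [sub_mulVec, smul_mulVec, dotProduct_sub, dotProduct_smul, smul_eq_mul] at h3 ⊢
  have h5 : 0 ≤ c * (c - 1) * (v ⬝ᵥ (N⁻¹ * S * N⁻¹) *ᵥ v) :=
    mul_nonneg (mul_nonneg (by linarith) (by linarith)) h2
  nlinarith

omit [DecidableEq ι] in
-- At a contact vector Xv = cZv the A-terms of c·riccati(Z) - riccati(X) cancel. If c > 1, what
-- remains is nonnegative, so the form of riccati(X) would be negative at v.
theorem posSemidef_sub_of_riccati {A S W X Z : Matrix ι ι ℝ} (hS : S.PosSemidef)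
    (hW : W.PosSemidef) (hZ : Z.PosDef) (hZr : ∀ v ≠ 0, v ⬝ᵥ riccati A S W Z *ᵥ v < 0)
    (hX : Xᵀ = X) (hXr : (riccati A S W X).PosSemidef) : (Z - X).PosSemidef := by
  cases isEmpty_or_nonempty ι
  · exact posSemidef_of_quad (Subsingleton.elim _ _) fun v => by simp
  obtain ⟨c, hc, v, hv, hcv⟩ := exists_extremal_ratio hZ hX
  have hc1 : c ≤ 1 := by
    by_contra! hlt
    have h1 := hXr.quad_nonneg v
    have h2 := hZr v hv
    rw [quad_riccati A S W hX, hcv] at h1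
    rw [quad_riccati A S W hZ.posSemidef.transpose_eq] at h2
    rw [quad_smul, smul_dotProduct, smul_eq_mul] at h1
    have hs := hS.quad_nonneg (Z *ᵥ v)
    have hw := hW.quad_nonneg v
    have h3 : 0 ≤ (c * (c - 1)) * ((Z *ᵥ v) ⬝ᵥ S *ᵥ (Z *ᵥ v)) :=
      mul_nonneg (mul_nonneg (by linarith) (by linarith)) hs
    have h4 := mul_nonneg (sub_nonneg.2 hlt.le) hw
    nlinarith
  have := hc.add (hZ.posSemidef.smul (sub_nonneg.2 hc1))
  convert this using 1
  module

open scoped Matrix.Norms.Elementwise in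
omit [DecidableEq ι] in
theorem isCompact_of_posSemidef_of_trace_le {K : Set (Matrix ι ι ℝ)} (hK : IsClosed K) (c : ℝ)
    (h : ∀ X ∈ K, X.PosSemidef ∧ X.trace ≤ c) : IsCompact K := by
  refine Metric.isCompact_of_isClosed_isBounded hK
    ((Metric.isBounded_iff_subset_closedBall 0).2 ⟨max c 0, fun X hX => ?_⟩)
  rw [mem_closedBall_zero_iff, Matrix.norm_le_iff (le_max_right _ _)]
  exact fun i j => ((h X hX).1.abs_apply_le_trace i j).trans ((h X hX).2.trans (le_max_left _ _))

omit [DecidableEq ι] in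
theorem continuous_riccati (A S W : Matrix ι ι ℝ) : Continuous (riccati A S W) := by
  unfold riccati; fun_prop

/-- Existence of a stabilizing solution of the Riccati equation, as the subsolution of maximal
trace. -/
theorem exists_riccati_eq_zero {A S W : Matrix ι ι ℝ}
    (hctr : ∀ v, (∀ k : ℕ, S *ᵥ (Aᵀ ^ k *ᵥ v) = 0) → v = 0)
    (hobs : ∀ v, (∀ k : ℕ, W *ᵥ (A ^ k *ᵥ v) = 0) → v = 0) (hS : S.PosSemidef)
    (hW : W.PosSemidef) : ∃ P : Matrix ι ι ℝ, P.PosDef ∧ riccati A S W P = 0 := by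
  obtain ⟨Z, hZ, hZr⟩ := exists_riccati_supersolution (W := W) hctr hS hW
  set K : Set (Matrix ι ι ℝ) := {X | X.PosSemidef ∧ (riccati A S W X).PosSemidef} with hK
  have hKc : IsCompact K := by
    refine isCompact_of_posSemidef_of_trace_le
      (isClosed_setOf_posSemidef.inter (isClosed_setOf_posSemidef.preimage
        (continuous_riccati A S W))) Z.trace fun X hX => ⟨hX.1, ?_⟩
    have := (posSemidef_sub_of_riccati hS hW hZ hZr hX.1.transpose_eq hX.2).trace_nonneg
    rw [trace_sub] at this
    linarith
  obtain ⟨X, hX, hmax⟩ := hKc.exists_isMaxOn (f := trace)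
    ⟨0, .zero, by simpa [riccati] using hW⟩ (by fun_prop)
  suffices h : riccati A S W X = 0 from ⟨X, posDef_of_riccati_eq_zero hobs hW hX.1 h, h⟩
  by_contra hD
  -- With D the nonzero residual at X, Y solves the Lyapunov equation whose linear part equals l Y -
  -- D. The residual at X + eY is then (1 - e) D + e (l Y - e Y S Y), still semidefinite for small
  -- e, while the trace has grown.
  obtain ⟨l, hl, hlyap⟩ := exists_lyapunov (A - S * X)
  obtain ⟨Y, hY, hYD⟩ := hlyap _ hX.2
  have hY0 : Y ≠ 0 := by
    rintro rfl
    exact hD (by simpa using hYD.symm)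
  set k := entrySum S * (Fintype.card ι : ℝ) ^ 2 * Y.trace with hk
  have hk0 : 0 ≤ k := mul_nonneg (mul_nonneg (entrySum_nonneg S) (sq_nonneg _)) hY.trace_nonneg
  obtain ⟨e, he0, he1, hek⟩ : ∃ e : ℝ, 0 < e ∧ e ≤ 1 ∧ e * k ≤ l := by
    refine ⟨min 1 (l / (k + 1)), lt_min one_pos (by positivity), min_le_left _ _, ?_⟩
    calc min 1 (l / (k + 1)) * k ≤ l / (k + 1) * k := by gcongr; exact min_le_right _ _
      _ ≤ l / (k + 1) * (k + 1) := by gcongr; linarith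
      _ = l := div_mul_cancel₀ _ (by positivity)
  have hadd : riccati A S W (X + e • Y) =
      (1 - e) • riccati A S W X + e • (l • Y - e • (Y * S * Y)) := by
    rw [riccati_add A S W X _ hS.transpose_eq hX.1.transpose_eq]
    have h1 : (A - S * X)ᵀ * Y + Y * (A - S * X) = l • Y - riccati A S W X := by
      rw [← hYD]; abel
    have h2 : (A - S * X)ᵀ * (e • Y) + (e • Y) * (A - S * X) =
        e • (l • Y - riccati A S W X) := by
      rw [← h1]; simp only [Matrix.mul_smul, Matrix.smul_mul, smul_add]
    rw [h2]
    simp only [Matrix.mul_smul, Matrix.smul_mul]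
    module
  have hmem : X + e • Y ∈ K := by
    refine ⟨hX.1.add (hY.smul he0.le), ?_⟩
    rw [hadd]
    refine (hX.2.smul (sub_nonneg.2 he1)).add (PosSemidef.smul ?_ he0.le)
    refine posSemidef_of_quad ?_ fun v => ?_
    · simp [hY.transpose_eq, hS.transpose_eq, Matrix.mul_assoc]
    · have h1 := hY.quad_mulVec_le S v
      have h2 := hY.quad_nonneg v
      simp only [sub_mulVec, smul_mulVec, dotProduct_sub, dotProduct_smul, smul_eq_mul,
        ← mulVec_mulVec, dotProduct_mulVec_of_symm hY.transpose_eq v (S *ᵥ _)]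
      rw [← hk] at h1
      have h3 := mul_le_mul_of_nonneg_left h1 he0.le
      have h4 := mul_le_mul_of_nonneg_right hek h2
      linarith
  have h1 : (X + e • Y).trace ≤ X.trace := hmax hmem
  rw [trace_add, trace_smul, smul_eq_mul] at h1
  have := mul_pos he0 (hY.trace_pos hY0)
  linarith

/-- On ker(cQ - P) with c > 1 the difference of the two equations forces the S- and W-terms to
vanish; the equations then show the kernel to be A-invariant. Observability excludes this, so c ≤ 1.
-/
theorem posSemidef_sub_of_riccati_eq_zero {A S W P Q : Matrix ι ι ℝ}
    (hobs : ∀ v, (∀ k : ℕ, W *ᵥ (A ^ k *ᵥ v) = 0) → v = 0) (hS : S.PosSemidef)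
    (hW : W.PosSemidef) (hP : P.PosDef) (hQ : Q.PosDef) (hPr : riccati A S W P = 0)
    (hQr : riccati A S W Q = 0) : (Q - P).PosSemidef := by
  cases isEmpty_or_nonempty ι
  · exact posSemidef_of_quad (Subsingleton.elim _ _) fun v => by simp
  have hPt := hP.posSemidef.transpose_eq
  have hQt := hQ.posSemidef.transpose_eq
  obtain ⟨c, hc, v, hv, hcv⟩ := exists_extremal_ratio hQ hPt
  have hc1 : c ≤ 1 := by
    by_contra! hlt
    refine hv (mulVec_eq_zero_of_invariant hobs (M := c • Q - P) (fun w hw => ?_) v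
      (by rw [sub_mulVec, smul_mulVec, hcv, sub_self]))
    have hPQ : P *ᵥ w = c • Q *ᵥ w := by
      rw [sub_mulVec, smul_mulVec, sub_eq_zero] at hw; exact hw.symm
    have h1 := quad_riccati A S W hPt w
    have h2 := quad_riccati A S W hQt w
    rw [hPr, zero_mulVec, dotProduct_zero, hPQ, quad_smul, smul_dotProduct, smul_eq_mul] at h1
    rw [hQr, zero_mulVec, dotProduct_zero] at h2
    have hs := hS.quad_nonneg (Q *ᵥ w)
    have hw := hW.quad_nonneg w
    have h3 : c * ((Q *ᵥ w) ⬝ᵥ S *ᵥ (Q *ᵥ w)) + w ⬝ᵥ W *ᵥ w = 0 := by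
      have : (c - 1) * (c * ((Q *ᵥ w) ⬝ᵥ S *ᵥ (Q *ᵥ w)) + w ⬝ᵥ W *ᵥ w) = 0 := by
        linear_combination h1 - c * h2
      exact (mul_eq_zero.1 this).resolve_left (by linarith)
    have h4 : 0 ≤ c * ((Q *ᵥ w) ⬝ᵥ S *ᵥ (Q *ᵥ w)) := mul_nonneg (by linarith) hs
    have hWw : W *ᵥ w = 0 := hW.mulVec_eq_zero (by linarith)
    have hSw : S *ᵥ (Q *ᵥ w) = 0 := by
      refine hS.mulVec_eq_zero ?_
      have : c * ((Q *ᵥ w) ⬝ᵥ S *ᵥ (Q *ᵥ w)) = 0 := by linarith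
      exact (mul_eq_zero.1 this).resolve_left (by linarith)
    refine ⟨hWw, ?_⟩
    have h5 : riccati A S W P *ᵥ w = 0 := by rw [hPr, zero_mulVec]
    have h6 : riccati A S W Q *ᵥ w = 0 := by rw [hQr, zero_mulVec]
    simp only [riccati, sub_mulVec, add_mulVec, ← mulVec_mulVec, hPQ, hWw, mulVec_smul, hSw,
      mulVec_zero, smul_zero, sub_zero, add_zero] at h5 h6
    rw [sub_mulVec, smul_mulVec, sub_eq_zero]
    have h7 := congrArg (c • ·) h6
    simp only [smul_add, smul_zero] at h7
    exact (add_left_cancel (h5.trans h7.symm)).symm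
  have := hc.add (hQ.posSemidef.smul (sub_nonneg.2 hc1))
  convert this using 1
  module

theorem riccati_eq_zero_unique {A S W P Q : Matrix ι ι ℝ}
    (hobs : ∀ v, (∀ k : ℕ, W *ᵥ (A ^ k *ᵥ v) = 0) → v = 0) (hS : S.PosSemidef)
    (hW : W.PosSemidef) (hP : P.PosDef) (hQ : Q.PosDef) (hPr : riccati A S W P = 0)
    (hQr : riccati A S W Q = 0) : P = Q := by
  have h1 := posSemidef_sub_of_riccati_eq_zero hobs hS hW hP hQ hPr hQr
  have h2 := posSemidef_sub_of_riccati_eq_zero hobs hS hW hQ hP hQr hPr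
  have h3 := h1.trace_nonneg
  have h4 := h2.trace_nonneg
  rw [trace_sub] at h3 h4
  have h5 := h1.trace_eq_zero_iff.1 (by rw [trace_sub]; linarith)
  exact (sub_eq_zero.1 h5).symm

end Riccati

/-! ### The homogenized field: superadditivity, quasimonotonicity, eigenrays -/

section HomogeneousField

variable {ι : Type*} [Fintype ι]

/-- The homogeneous Riccati field `α (Aᵀ X + X A) - (tr X)⁻¹ X S X + α² (tr X) W`. -/
noncomputable def homField (A S W : Matrix ι ι ℝ) (α : ℝ) (X : Matrix ι ι ℝ) : Matrix ι ι ℝ :=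
  α • (Aᵀ * X) + α • (X * A) - (1 / X.trace) • (X * S * X) + (α ^ 2 * X.trace) • W

variable {A S W X Z : Matrix ι ι ℝ} {α : ℝ}

theorem quad_homField (A S W : Matrix ι ι ℝ) (α : ℝ) (hX : Xᵀ = X) (v : ι → ℝ) :
    v ⬝ᵥ homField A S W α X *ᵥ v =
      2 * α * ((X *ᵥ v) ⬝ᵥ (A *ᵥ v)) - 1 / X.trace * ((X *ᵥ v) ⬝ᵥ S *ᵥ (X *ᵥ v)) +
        α ^ 2 * X.trace * (v ⬝ᵥ W *ᵥ v) := by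
  simp only [homField, sub_mulVec, add_mulVec, smul_mulVec, ← mulVec_mulVec, dotProduct_sub,
    dotProduct_add, dotProduct_smul, smul_eq_mul, dot_transpose_mulVec,
    dotProduct_mulVec_of_symm hX v, dotProduct_comm (A *ᵥ v)]
  ring

theorem homField_mulVec (v : ι → ℝ) :
    homField A S W α X *ᵥ v = α • (Aᵀ *ᵥ (X *ᵥ v)) + α • (X *ᵥ (A *ᵥ v)) -
      (1 / X.trace) • (X *ᵥ (S *ᵥ (X *ᵥ v))) + (α ^ 2 * X.trace) • (W *ᵥ v) := by
  simp only [homField, sub_mulVec, add_mulVec, smul_mulVec, ← mulVec_mulVec]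

theorem homField_transpose (hS : Sᵀ = S) (hW : Wᵀ = W) :
    (homField A S W α X)ᵀ = homField A S W α Xᵀ := by
  simp only [homField, transpose_add, transpose_sub, transpose_smul, transpose_mul,
    transpose_transpose, hS, hW, trace_transpose, Matrix.mul_assoc]
  rw [add_comm (α • (Xᵀ * A))]

theorem homField_smul (c : ℝ) (hc : c ≠ 0) :
    homField A S W α (c • X) = c • homField A S W α X := by
  simp only [homField, trace_smul, Matrix.mul_smul, Matrix.smul_mul, smul_eq_mul, smul_add,
    smul_sub, smul_smul]
  rw [show 1 / (c * X.trace) * (c * c) = c * (1 / X.trace) by field_simp, mul_comm α c,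
    show α ^ 2 * (c * X.trace) = c * (α ^ 2 * X.trace) by ring]

theorem homField_zero : homField A S W α 0 = 0 := by simp [homField]

/-- This dictates α: when α tr X = 1 the coefficients α, 1 / tr X and α² tr X coincide. -/
theorem homField_eq_riccati (hX : X.trace ≠ 0) (hα : α = 1 / X.trace) :
    homField A S W α X = α • riccati A S W X := by
  have : α ^ 2 * X.trace = α := by rw [hα]; field_simp
  simp only [homField, riccati, this, ← hα]
  module

/-- Superadditivity of the homogeneous Riccati field, in the sense of quadratic forms. -/
theorem homField_superadditive (hS : S.PosSemidef) (hZ : Zᵀ = Z) (hXZ : (X - Z).PosSemidef)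
    (hZ0 : 0 ≤ Z.trace) (hZ1 : Z.trace = 0 → Z = 0) (v : ι → ℝ) :
    v ⬝ᵥ homField A S W α Z *ᵥ v + v ⬝ᵥ homField A S W α (X - Z) *ᵥ v ≤
      v ⬝ᵥ homField A S W α X *ᵥ v := by
  obtain ⟨H, rfl⟩ : ∃ H, X = Z + H := ⟨X - Z, by abel⟩
  rw [add_sub_cancel_left] at hXZ ⊢
  have hH := hXZ.transpose_eq
  rcases hZ0.eq_or_lt with h0 | hz
  · rw [hZ1 h0.symm, homField_zero]; simp
  rcases hXZ.trace_nonneg.eq_or_lt with h0 | hh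
  · rw [hXZ.trace_eq_zero_iff.1 h0.symm, homField_zero]; simp
  rw [quad_homField A S W α hZ, quad_homField A S W α hH,
    quad_homField A S W α (by simp [hZ, hH]), trace_add]
  simp only [add_mulVec, mulVec_add, add_dotProduct, dotProduct_add]
  set z := Z *ᵥ v
  set y := H *ᵥ v
  set a := Z.trace
  set b := H.trace
  have hzy : z ⬝ᵥ S *ᵥ y = y ⬝ᵥ S *ᵥ z := by
    rw [dotProduct_mulVec_of_symm hS.transpose_eq, dotProduct_comm]
  -- This square expresses joint convexity of (z, t) ↦ z·Sz / t; the linear terms of the field are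
  -- additive.
  have h1 := hS.quad_nonneg (b • z - a • y)
  simp only [mulVec_sub, mulVec_smul, dotProduct_sub, sub_dotProduct, dotProduct_smul,
    smul_dotProduct, smul_eq_mul, hzy] at h1
  rw [hzy]
  set p := z ⬝ᵥ S *ᵥ z
  set q := y ⬝ᵥ S *ᵥ z
  set r := y ⬝ᵥ S *ᵥ y
  have h2 : 0 ≤ 1 / a * p + 1 / b * r - 1 / (a + b) * (p + q + (q + r)) := by
    have : 1 / a * p + 1 / b * r - 1 / (a + b) * (p + q + (q + r)) =
        (b * (b * p - a * q) - a * (b * q - a * r)) / (a * b * (a + b)) := by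
      field_simp; ring
    rw [this]
    exact div_nonneg (by linarith) (by positivity)
  linarith

/-- Quasimonotonicity of the homogeneous Riccati field, in quantitative form. -/
theorem homField_quasimonotone (hS : S.PosSemidef) (hW : W.PosSemidef) (hX : Xᵀ = X)
    (hZ : Zᵀ = Z) (hX0 : 0 < X.trace) (hZ0 : 0 ≤ Z.trace) (hZ1 : Z.trace = 0 → Z = 0) {e : ℝ}
    (he : 0 < e) {v : ι → ℝ} (hv : (X - Z) *ᵥ v = (-e) • v)
    (ht : -((Fintype.card ι : ℝ) * e) ≤ (X - Z).trace) :
    -(entrySum ((2 * α) • A - (2 / X.trace) • (S * X) +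
        ((Fintype.card ι : ℝ) / X.trace ^ 2) • (X * S * X) +
        ((Fintype.card ι : ℝ) * α ^ 2) • W) * e) * (v ⬝ᵥ v) ≤
      v ⬝ᵥ (homField A S W α X - homField A S W α Z) *ᵥ v := by
  set m : ℝ := (Fintype.card ι : ℝ)
  set M := (2 * α) • A - (2 / X.trace) • (S * X) + (m / X.trace ^ 2) • (X * S * X) +
    (m * α ^ 2) • W with hM
  have hMq : v ⬝ᵥ M *ᵥ v ≤ entrySum M * (v ⬝ᵥ v) := (le_abs_self _).trans (abs_quad_le M v)
  have hMe : v ⬝ᵥ M *ᵥ v = 2 * α * (v ⬝ᵥ A *ᵥ v) - 2 / X.trace * (v ⬝ᵥ S *ᵥ (X *ᵥ v)) +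
      m / X.trace ^ 2 * ((X *ᵥ v) ⬝ᵥ S *ᵥ (X *ᵥ v)) + m * α ^ 2 * (v ⬝ᵥ W *ᵥ v) := by
    simp only [hM, add_mulVec, sub_mulVec, smul_mulVec, ← mulVec_mulVec, dotProduct_add,
      dotProduct_sub, dotProduct_smul, smul_eq_mul, dotProduct_mulVec_of_symm hX v]
  suffices h : -(e * (v ⬝ᵥ M *ᵥ v)) ≤ v ⬝ᵥ (homField A S W α X - homField A S W α Z) *ᵥ v by
    have := mul_le_mul_of_nonneg_left hMq he.le
    linarith
  have hz : Z *ᵥ v = X *ᵥ v + e • v := by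
    rw [sub_mulVec, sub_eq_iff_eq_add] at hv
    rw [hv]; module
  rw [trace_sub] at ht
  have hw := hW.quad_nonneg v
  rw [sub_mulVec, dotProduct_sub, quad_homField A S W α hX, quad_homField A S W α hZ, hMe]
  set a := X.trace with ha
  set b := Z.trace with hb
  have hzA : (Z *ᵥ v) ⬝ᵥ (A *ᵥ v) = (X *ᵥ v) ⬝ᵥ (A *ᵥ v) + e * (v ⬝ᵥ A *ᵥ v) := by
    rw [hz, add_dotProduct, smul_dotProduct, smul_eq_mul]
  have hzS : (Z *ᵥ v) ⬝ᵥ S *ᵥ (X *ᵥ v) =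
      (X *ᵥ v) ⬝ᵥ S *ᵥ (X *ᵥ v) + e * (v ⬝ᵥ S *ᵥ (X *ᵥ v)) := by
    rw [hz, add_dotProduct, smul_dotProduct, smul_eq_mul]
  have hxx := hS.quad_nonneg (X *ᵥ v)
  have hxz : (X *ᵥ v) ⬝ᵥ S *ᵥ (Z *ᵥ v) = (Z *ᵥ v) ⬝ᵥ S *ᵥ (X *ᵥ v) := by
    rw [dotProduct_mulVec_of_symm hS.transpose_eq, dotProduct_comm]
  -- Tangent inequality for the convex function (z, t) ↦ z·Sz / t at (Xv, tr X). At Z = 0 both sides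
  -- vanish, since 1 / 0 = 0.
  have htangent : 2 / a * ((Z *ᵥ v) ⬝ᵥ S *ᵥ (X *ᵥ v)) -
      b / a ^ 2 * ((X *ᵥ v) ⬝ᵥ S *ᵥ (X *ᵥ v)) ≤ 1 / b * ((Z *ᵥ v) ⬝ᵥ S *ᵥ (Z *ᵥ v)) := by
    rcases hZ0.eq_or_lt with h0 | hb0
    · rw [← h0, hZ1 h0.symm]; simp
    have h1 := hS.quad_nonneg (a • (Z *ᵥ v) - b • (X *ᵥ v))
    simp only [mulVec_sub, mulVec_smul, dotProduct_sub, sub_dotProduct, dotProduct_smul,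
      smul_dotProduct, smul_eq_mul, hxz] at h1
    rw [← sub_nonneg]
    set p := (Z *ᵥ v) ⬝ᵥ S *ᵥ (Z *ᵥ v)
    set q := (Z *ᵥ v) ⬝ᵥ S *ᵥ (X *ᵥ v)
    set r := (X *ᵥ v) ⬝ᵥ S *ᵥ (X *ᵥ v)
    have : 1 / b * p - (2 / a * q - b / a ^ 2 * r) =
        (a * (a * p - b * q) - b * (a * q - b * r)) / (a ^ 2 * b) := by
      field_simp; ring
    rw [this]
    exact div_nonneg (by linarith) (by positivity)
  rw [hzS] at htangent
  rw [hzA]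
  set x := (X *ᵥ v) ⬝ᵥ S *ᵥ (X *ᵥ v)
  -- The trace of Z may exceed that of X by at most m e, so the trace-dependent terms cost only
  -- O(e).
  have h3 : 0 ≤ (a - b + m * e) * (x / a ^ 2 + α ^ 2 * (v ⬝ᵥ W *ᵥ v)) :=
    mul_nonneg (by linarith) (by positivity)
  have h4 : 2 / a * x = 1 / a * x + a / a ^ 2 * x := by field_simp; ring
  have h5 : (a - b + m * e) * (x / a ^ 2 + α ^ 2 * (v ⬝ᵥ W *ᵥ v)) =
      a / a ^ 2 * x - b / a ^ 2 * x + e * (m / a ^ 2 * x) +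
        (a - b + m * e) * (α ^ 2 * (v ⬝ᵥ W *ᵥ v)) := by ring
  have h6 : 2 / a * (x + e * (v ⬝ᵥ S *ᵥ (X *ᵥ v))) =
      2 / a * x + e * (2 / a * (v ⬝ᵥ S *ᵥ (X *ᵥ v))) := by ring
  rw [h5] at h3
  rw [h6, h4] at htangent
  linarith

/-- At a contact vector the A-terms cancel, and both remaining terms increase with the trace. -/
theorem quad_homField_sub_nonneg (hS : S.PosSemidef) (hW : W.PosSemidef) (hX : Xᵀ = X)
    (hZ : Zᵀ = Z) (hZ0 : 0 < Z.trace) (hXZ : Z.trace ≤ X.trace) {v : ι → ℝ}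
    (hv : X *ᵥ v = Z *ᵥ v) :
    0 ≤ v ⬝ᵥ homField A S W α X *ᵥ v - v ⬝ᵥ homField A S W α Z *ᵥ v := by
  rw [quad_homField A S W α hX, quad_homField A S W α hZ, hv]
  have h1 := mul_nonneg (sub_nonneg.2 (one_div_le_one_div_of_le hZ0 hXZ))
    (hS.quad_nonneg (Z *ᵥ v))
  have h2 := mul_nonneg (mul_nonneg (sq_nonneg α) (sub_nonneg.2 hXZ)) (hW.quad_nonneg v)
  linarith

variable [DecidableEq ι]

theorem posDef_of_homField_eq_smul (hα : 0 < α)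
    (hobs : ∀ v, (∀ k : ℕ, W *ᵥ (A ^ k *ᵥ v) = 0) → v = 0) (hW : W.PosSemidef)
    (hX : X.PosSemidef) (hX0 : X ≠ 0) {μ : ℝ} (h : homField A S W α X = μ • X) : X.PosDef := by
  refine hX.posDef_of_ker (mulVec_eq_zero_of_invariant hobs fun v hv => ?_)
  have h1 := quad_homField A S W α hX.transpose_eq v
  rw [h, smul_mulVec, hv] at h1
  have h2 : W *ᵥ v = 0 := by
    refine hW.mulVec_eq_zero ?_
    have : α ^ 2 * X.trace ≠ 0 := mul_ne_zero (pow_ne_zero _ hα.ne') (hX.trace_pos hX0).ne'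
    simpa [this] using h1.symm
  refine ⟨h2, ?_⟩
  have h3 : homField A S W α X *ᵥ v = 0 := by rw [h, smul_mulVec, hv, smul_zero]
  rw [homField_mulVec, hv, h2] at h3
  simpa [hα.ne'] using h3

/-- The homogeneous Riccati field has at most one equilibrium ray in the cone, and no other
eigenray. -/
theorem homField_eigenray [Nonempty ι] (hα : 0 < α)
    (hobs : ∀ v, (∀ k : ℕ, W *ᵥ (A ^ k *ᵥ v) = 0) → v = 0) (hS : S.PosSemidef)
    (hW : W.PosSemidef) {P : Matrix ι ι ℝ} (hP : P.PosDef) (hP0 : homField A S W α P = 0)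
    (hX : X.PosSemidef) (hX0 : X ≠ 0) {μ : ℝ} (h : homField A S W α X = μ • X) :
    μ = 0 ∧ ∃ c : ℝ, 0 < c ∧ X = c • P := by
  have hXd := posDef_of_homField_eq_smul hα hobs hW hX hX0 h
  have hXt := hX.transpose_eq
  have hPt := hP.posSemidef.transpose_eq
  have htP := hP.trace_pos'
  have htX := hXd.trace_pos'
  have hcP : ∀ c : ℝ, 0 < c → homField A S W α (c • P) = 0 := fun c hc => by
    rw [homField_smul c hc.ne', hP0, smul_zero]
  have hpos : ∀ (c : ℝ) (v : ι → ℝ), v ≠ 0 → X *ᵥ v = c • P *ᵥ v → 0 < c := by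
    intro c v hv hcv
    have h1 := hXd.quad_pos hv
    rw [hcv, dotProduct_smul, smul_eq_mul] at h1
    exact pos_of_mul_pos_left h1 (hP.quad_pos hv).le
  obtain ⟨c, hc, v, hv, hcv⟩ := exists_extremal_ratio hP hXt
  obtain ⟨d, hd, w, hw, hdw⟩ := exists_extremal_ratio_lower hP hXt
  have hc0 := hpos c v hv hcv
  have hd0 := hpos d w hw hdw
  have htr : ∀ Y Z : Matrix ι ι ℝ, (Y - Z).PosSemidef → Z.trace ≤ Y.trace := by
    intro Y Z hYZ
    have := hYZ.trace_nonneg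
    rw [trace_sub] at this
    linarith
  have hct : (c • P)ᵀ = c • P := by rw [transpose_smul, hPt]
  have hdt : (d • P)ᵀ = d • P := by rw [transpose_smul, hPt]
  -- X touches cP from below at v and dP from above at w. Comparison with these equilibria gives μ ≤
  -- 0 and μ ≥ 0.
  have hμ : μ = 0 := by
    have h1 := quad_homField_sub_nonneg (A := A) (α := α) hS hW hct hXt htX (htr _ _ hc) (v := v)
      (by rw [smul_mulVec, hcv])
    have h2 := quad_homField_sub_nonneg (A := A) (α := α) hS hW hXt hdt
      (by rw [trace_smul]; exact mul_pos hd0 htP) (htr _ _ hd) (v := w) (by rw [smul_mulVec, hdw])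
    rw [hcP c hc0, h, zero_mulVec, dotProduct_zero, smul_mulVec, dotProduct_smul,
      smul_eq_mul] at h1
    rw [hcP d hd0, h, zero_mulVec, dotProduct_zero, smul_mulVec, dotProduct_smul,
      smul_eq_mul] at h2
    have h3 := hXd.quad_pos hv
    have h4 := hXd.quad_pos hw
    exact le_antisymm (by nlinarith) (by nlinarith)
  refine ⟨hμ, c, hc0, ?_⟩
  by_contra hne
  -- On the contact kernel the fields of X and cP now differ only through their traces. A strict gap
  -- forces the S- and W-terms to vanish, which makes the kernel A-invariant.
  have hlt : X.trace < (c • P).trace := by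
    have := hc.trace_pos (sub_ne_zero.2 (Ne.symm hne))
    rw [trace_sub] at this
    linarith
  refine hv (mulVec_eq_zero_of_invariant hobs (M := c • P - X) (fun u hu => ?_) v
    (by rw [sub_mulVec, smul_mulVec, hcv, sub_self]))
  have hu' : X *ᵥ u = (c • P) *ᵥ u := by rw [sub_mulVec, sub_eq_zero] at hu; exact hu.symm
  have hF1 : homField A S W α X = 0 := by rw [h, hμ, zero_smul]
  have hF2 := hcP c hc0
  have h1 := quad_homField A S W α hXt u
  have h2 := quad_homField A S W α hct u
  rw [hF1, zero_mulVec, dotProduct_zero, hu'] at h1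
  rw [hF2, zero_mulVec, dotProduct_zero] at h2
  have hs := hS.quad_nonneg ((c • P) *ᵥ u)
  have hw' := hW.quad_nonneg u
  have h3 : 0 < 1 / X.trace - 1 / (c • P).trace :=
    sub_pos.2 (one_div_lt_one_div_of_lt htX hlt)
  have h4 : 0 < α ^ 2 * ((c • P).trace - X.trace) := mul_pos (by positivity) (sub_pos.2 hlt)
  have h5 := mul_nonneg h3.le hs
  have h6 := mul_nonneg h4.le hw'
  have hWu : W *ᵥ u = 0 := by
    refine hW.mulVec_eq_zero ((mul_eq_zero.1 ?_).resolve_left h4.ne')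
    linarith
  have hSu : S *ᵥ ((c • P) *ᵥ u) = 0 := by
    refine hS.mulVec_eq_zero ((mul_eq_zero.1 ?_).resolve_left h3.ne')
    linarith
  refine ⟨hWu, ?_⟩
  have h7 := homField_mulVec (A := A) (S := S) (W := W) (α := α) (X := X) u
  have h8 := homField_mulVec (A := A) (S := S) (W := W) (α := α) (X := c • P) u
  rw [hF1, zero_mulVec, hu', hSu, hWu, mulVec_zero, smul_zero, smul_zero, sub_zero, add_zero] at h7
  rw [hF2, zero_mulVec, hSu, hWu, mulVec_zero, smul_zero, smul_zero, sub_zero, add_zero] at h8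
  have h9 := add_left_cancel (h8.symm.trans h7)
  rw [sub_mulVec, sub_eq_zero]
  exact smul_right_injective _ hα.ne' h9

end HomogeneousField

/-! ### Matrix curves: cone invariance and instant positivity -/

section MatrixCurves

variable {ι : Type*} [Fintype ι]

theorem hasDerivWithinAt_quad {H : ℝ → Matrix ι ι ℝ} {H' : Matrix ι ι ℝ} {w : ℝ → ι → ℝ}
    {w' : ι → ℝ} {s : Set ℝ} {t : ℝ}
    (hH : ∀ i j, HasDerivWithinAt (fun s => H s i j) (H' i j) s t)
    (hw : ∀ i, HasDerivWithinAt (fun s => w s i) (w' i) s t) :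
    HasDerivWithinAt (fun s => w s ⬝ᵥ H s *ᵥ w s)
      (w' ⬝ᵥ H t *ᵥ w t + w t ⬝ᵥ H' *ᵥ w t + w t ⬝ᵥ H t *ᵥ w') s t := by
  have h := HasDerivWithinAt.fun_sum (u := Finset.univ) fun i _ =>
    (hw i).mul (HasDerivWithinAt.fun_sum (u := Finset.univ) fun j _ => (hH i j).mul (hw j))
  refine (h.congr_deriv ?_)
  simp only [dotProduct, mulVec, Finset.sum_add_distrib, mul_add, Pi.mul_apply]
  ring

theorem nonpos_of_hasDerivWithinAt_of_le {f : ℝ → ℝ} {f' t : ℝ} (ht : 0 < t)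
    (hf : HasDerivWithinAt f f' (Set.Icc 0 t) t) (hmin : ∀ s ∈ Set.Icc 0 t, f t ≤ f s) :
    f' ≤ 0 := by
  have h1 : HasDerivWithinAt f f' (Set.Iio t) t :=
    (hf.mono_of_mem_nhdsWithin (s := Set.Iic t) (Icc_mem_nhdsLE ht)).mono Set.Iio_subset_Iic_self
  rw [hasDerivWithinAt_iff_tendsto_slope' (by simp)] at h1
  refine le_of_tendsto h1 ?_
  filter_upwards [Ioo_mem_nhdsLT ht] with s hs
  rw [slope_def_field]
  exact div_nonpos_of_nonneg_of_nonpos (sub_nonneg.2 (hmin s ⟨hs.1.le, hs.2.le⟩))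
    (by linarith [hs.2])

variable [DecidableEq ι]

/-- Invariance of the semidefinite cone under quasimonotone evolution. -/
theorem posSemidef_of_quasimonotone {H H' : ℝ → Matrix ι ι ℝ} {T k : ℝ}
    (hd : ∀ t ∈ Set.Icc 0 T, ∀ i j,
      HasDerivWithinAt (fun s => H s i j) (H' t i j) (Set.Icc 0 T) t)
    (hsymm : ∀ t ∈ Set.Icc 0 T, (H t)ᵀ = H t) (h0 : (H 0).PosSemidef)
    (hq : ∀ t ∈ Set.Icc 0 T, ∀ e > 0, ∀ v, H t *ᵥ v = (-e) • v →
      -((Fintype.card ι : ℝ) * e) ≤ (H t).trace → -(k * e) * (v ⬝ᵥ v) ≤ v ⬝ᵥ H' t *ᵥ v) :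
    ∀ t ∈ Set.Icc 0 T, (H t).PosSemidef := by
  by_contra! hcon
  obtain ⟨t₀, ht₀, hneg⟩ := hcon
  obtain ⟨v₀, hv₀, hv₀'⟩ : ∃ v, v ⬝ᵥ v = 1 ∧ v ⬝ᵥ H t₀ *ᵥ v < 0 := by
    by_contra! h
    exact hneg (posSemidef_of_unit (hsymm t₀ ht₀) h)
  obtain ⟨ε, hε, hε'⟩ : ∃ ε > 0, v₀ ⬝ᵥ H t₀ *ᵥ v₀ + ε * Real.exp ((k + 1) * t₀) ≤ 0 := by
    refine ⟨-(v₀ ⬝ᵥ H t₀ *ᵥ v₀) / Real.exp ((k + 1) * t₀),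
      div_pos (by linarith) (Real.exp_pos _), ?_⟩
    rw [div_mul_cancel₀ _ (Real.exp_ne_zero _)]
    linarith
  -- A barrier growing at rate k + 1, one more than `hq` can consume. By the choice of ε the form of
  -- H + e·1 is still nonpositive at time t₀ and vector v₀.
  set e : ℝ → ℝ := fun t => ε * Real.exp ((k + 1) * t) with he
  have hepos : ∀ t, 0 < e t := fun t => mul_pos hε (Real.exp_pos _)
  have hecont : Continuous e := by fun_prop
  have hHcont : ContinuousOn H (Set.Icc 0 T) :=
    continuousOn_pi.2 fun i => continuousOn_pi.2 fun j t ht => (hd t ht i j).continuousWithinAt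
  set K : Set (ℝ × (ι → ℝ)) := (Set.Icc 0 T ×ˢ {v | v ⬝ᵥ v = 1}) ∩
    {q | q.2 ⬝ᵥ H q.1 *ᵥ q.2 + e q.1 ≤ 0} with hK
  have hgcont : ContinuousOn (fun q : ℝ × (ι → ℝ) => q.2 ⬝ᵥ H q.1 *ᵥ q.2 + e q.1)
      (Set.Icc 0 T ×ˢ {v | v ⬝ᵥ v = 1}) := by
    refine ContinuousOn.add ?_ (hecont.comp continuous_fst).continuousOn
    refine continuous_quad.comp_continuousOn (ContinuousOn.prodMk ?_ continuousOn_snd)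
    exact hHcont.comp continuousOn_fst fun q hq => hq.1
  have hKc : IsCompact K := by
    have hc : IsCompact (Set.Icc 0 T ×ˢ {v : ι → ℝ | v ⬝ᵥ v = 1}) :=
      isCompact_Icc.prod isCompact_unit
    exact hc.of_isClosed_subset
      (hgcont.preimage_isClosed_of_isClosed hc.isClosed isClosed_Iic) Set.inter_subset_left
  -- First contact time of the form of H + e·1 with zero, and a unit vector realizing it.
  obtain ⟨⟨t, v⟩, ⟨⟨ht, hv⟩, hle⟩, hmin⟩ := hKc.exists_isMinOn
    (f := Prod.fst) ⟨(t₀, v₀), ⟨ht₀, hv₀⟩, hε'⟩ continuousOn_fst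
  simp only [Set.mem_ofPred_eq] at hv hle ht
  have hlt : ∀ s ∈ Set.Icc 0 T, s < t → ∀ u, u ⬝ᵥ u = 1 → 0 < u ⬝ᵥ H s *ᵥ u + e s := by
    intro s hs hst u hu
    by_contra! hc
    exact absurd (hmin (a := (s, u)) ⟨⟨hs, hu⟩, hc⟩) (not_le.2 hst)
  have htpos : 0 < t := by
    rcases ht.1.eq_or_lt with h | h
    · subst h
      have := h0.quad_nonneg v
      have := hepos 0
      linarith
    · exact h
  have hge : ∀ u, u ⬝ᵥ u = 1 → 0 ≤ u ⬝ᵥ H t *ᵥ u + e t := by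
    intro u hu
    have hc : ContinuousWithinAt (fun s => u ⬝ᵥ H s *ᵥ u + e s) (Set.Iio t) t := by
      have h1 : ContinuousWithinAt (fun s => u ⬝ᵥ H s *ᵥ u + e s) (Set.Icc 0 T) t :=
        (hgcont (t, u) ⟨ht, hu⟩).comp (f := fun s => (s, u)) (by fun_prop) fun s hs => ⟨hs, hu⟩
      have h2 : ContinuousWithinAt (fun s => u ⬝ᵥ H s *ᵥ u + e s) (Set.Ioo 0 t) t :=
        h1.mono fun s hs => ⟨hs.1.le, hs.2.le.trans ht.2⟩
      exact h2.mono_of_mem_nhdsWithin (Ioo_mem_nhdsLT htpos)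
    refine ge_of_tendsto hc ?_
    filter_upwards [Ioo_mem_nhdsLT htpos] with s hs
    exact (hlt s ⟨hs.1.le, hs.2.le.trans ht.2⟩ hs.2 u hu).le
  have hps : (H t + e t • (1 : Matrix ι ι ℝ)).PosSemidef := by
    refine posSemidef_of_unit (by simp [hsymm t ht]) fun u hu => ?_
    have := hge u hu
    simpa [add_mulVec, smul_mulVec, hu] using this
  have hker : H t *ᵥ v = (-e t) • v := by
    have h1 := hps.mulVec_eq_zero (v := v) (by
      have := hge v hv
      simp only [add_mulVec, smul_mulVec, one_mulVec, dotProduct_add, dotProduct_smul, hv,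
        smul_eq_mul, mul_one]
      linarith)
    rw [add_mulVec, smul_mulVec, one_mulVec] at h1
    rw [neg_smul]
    exact eq_neg_of_add_eq_zero_left h1
  have htr : -((Fintype.card ι : ℝ) * e t) ≤ (H t).trace := by
    have := hps.trace_nonneg
    rw [trace_add, trace_smul, trace_one, smul_eq_mul] at this
    linarith
  have h1 := hq t ht (e t) (hepos t) v hker htr
  have hsub : Set.Icc 0 t ⊆ Set.Icc 0 T := Set.Icc_subset_Icc le_rfl ht.2
  have hderiv : HasDerivWithinAt (fun s => v ⬝ᵥ H s *ᵥ v + e s)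
      (v ⬝ᵥ H' t *ᵥ v + (k + 1) * e t) (Set.Icc 0 t) t := by
    have h2 := hasDerivWithinAt_quad (w := fun _ => v) (w' := 0)
      (fun i j => (hd t ht i j).mono hsub) fun i => hasDerivWithinAt_const _ _ _
    have h3 : HasDerivAt e ((k + 1) * e t) t := by
      have := (((hasDerivAt_id t).const_mul (k + 1)).exp).const_mul ε
      refine this.congr_deriv ?_
      simp [he]; ring
    refine (h2.add h3.hasDerivWithinAt).congr_deriv ?_
    simp
  -- At first contact the left derivative is at most 0, whereas `hq` bounds it below by -k e + (k +
  -- 1) e = e > 0.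
  have h4 := nonpos_of_hasDerivWithinAt_of_le htpos hderiv fun s hs => by
    rcases hs.2.eq_or_lt with h | h
    · rw [h]
    · exact hle.trans (hlt s (hsub hs) h v hv).le
  rw [hv] at h1
  have := hepos t
  linarith

open scoped Matrix.Norms.Operator in
-- The solution is exp((s - t₁) M) v; invertibility of the exponential means that a nonzero solution
-- never vanishes.
theorem exists_linear_flow (M : Matrix ι ι ℝ) (t₁ : ℝ) (v : ι → ℝ) :
    ∃ w : ℝ → ι → ℝ, w t₁ = v ∧ (∀ s i, HasDerivAt (fun s => w s i) ((M *ᵥ w s) i) s) ∧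
      ∀ s, w s = 0 → v = 0 := by
  refine ⟨fun s => NormedSpace.exp ((s - t₁) • M) *ᵥ v, by simp, fun s i => ?_, fun s hs => ?_⟩
  · have h1 : HasDerivAt (fun s => NormedSpace.exp ((s - t₁) • M))
        (M * NormedSpace.exp ((s - t₁) • M)) s := by
      have := (hasDerivAt_exp_smul_const' M (s - t₁)).scomp s ((hasDerivAt_id s).sub_const t₁)
      rw [one_smul] at this
      exact this
    let L : Matrix ι ι ℝ →L[ℝ] ℝ := LinearMap.toContinuousLinearMap
      (LinearMap.proj i ∘ₗ (Matrix.mulVecBilin ℝ ℝ).flip v)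
    have h2 := L.hasFDerivAt.comp_hasDerivAt s h1
    refine (h2.congr_deriv ?_ : _)
    change _ = (M *ᵥ (NormedSpace.exp ((s - t₁) • M) *ᵥ v)) i
    rw [mulVec_mulVec]
    rfl
  · have hu := Matrix.isUnit_exp ((s - t₁) • M)
    have := Matrix.mulVec_injective_of_isUnit hu
    exact this (by simpa using hs)

/-- Differentiating W A^k w = 0 along w' = -αAw yields W A^(k+1) w = 0. -/
theorem eq_zero_of_linear_flow {A W : Matrix ι ι ℝ} {α : ℝ} (hα : α ≠ 0)
    (hobs : ∀ v, (∀ k : ℕ, W *ᵥ (A ^ k *ᵥ v) = 0) → v = 0) {w : ℝ → ι → ℝ}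
    (hw : ∀ s i, HasDerivAt (fun s => w s i) (((-α • A) *ᵥ w s) i) s) {a b : ℝ}
    (h : ∀ s ∈ Set.Ioo a b, W *ᵥ w s = 0) {s : ℝ} (hs : s ∈ Set.Ioo a b) : w s = 0 := by
  have key : ∀ k : ℕ, ∀ s ∈ Set.Ioo a b, W *ᵥ (A ^ k *ᵥ w s) = 0 := by
    intro k
    induction k with
    | zero => simpa using h
    | succ k ih =>
      intro s hs
      have hz : ∀ i, HasDerivAt (fun s => ((W * A ^ k) *ᵥ w s) i)
          (((W * A ^ k) *ᵥ ((-α • A) *ᵥ w s)) i) s := by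
        intro i
        simp only [mulVec, dotProduct]
        exact HasDerivAt.fun_sum fun j _ => (hw s j).const_mul _
      have hz0 : ∀ i, HasDerivAt (fun s => ((W * A ^ k) *ᵥ w s) i) 0 s := by
        intro i
        refine (hasDerivAt_const s (0 : ℝ)).congr_of_eventuallyEq ?_
        filter_upwards [Ioo_mem_nhds hs.1 hs.2] with r hr
        rw [← mulVec_mulVec, ih r hr, Pi.zero_apply]
      have h1 : (W * A ^ k) *ᵥ ((-α • A) *ᵥ w s) = 0 :=
        funext fun i => (hz i).unique (hz0 i)
      rw [smul_mulVec, mulVec_smul, smul_eq_zero] at h1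
      rw [pow_succ, ← mulVec_mulVec, mulVec_mulVec]
      exact h1.resolve_left (neg_ne_zero.2 hα)
  exact hobs _ fun k => key k s hs

/-- A nonzero supersolution of the homogeneous Riccati equation becomes positive definite
instantly. -/
theorem posDef_of_supersolution {A S W : Matrix ι ι ℝ} {α : ℝ} (hα : 0 < α)
    (hobs : ∀ v, (∀ k : ℕ, W *ᵥ (A ^ k *ᵥ v) = 0) → v = 0) (hW : W.PosSemidef)
    {H H' : ℝ → Matrix ι ι ℝ} {T : ℝ} (hT : 0 < T)
    (hd : ∀ t ∈ Set.Icc 0 T, ∀ i j,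
      HasDerivWithinAt (fun s => H s i j) (H' t i j) (Set.Icc 0 T) t)
    (hps : ∀ t ∈ Set.Icc 0 T, (H t).PosSemidef) (h0 : H 0 ≠ 0)
    (hsup : ∀ t ∈ Set.Icc 0 T, ∀ v, v ⬝ᵥ homField A S W α (H t) *ᵥ v ≤ v ⬝ᵥ H' t *ᵥ v) :
    (H T).PosDef := by
  have hTm : T ∈ Set.Icc 0 T := ⟨hT.le, le_rfl⟩
  have h0m : (0 : ℝ) ∈ Set.Icc 0 T := ⟨le_rfl, hT.le⟩
  refine (hps T hTm).posDef_of_ker fun v hv => ?_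
  -- Moving the test vector along -αA, with w(T) = v, cancels the A-terms in the derivative of w·Hw.
  obtain ⟨w, hwT, hw, hw0⟩ := exists_linear_flow (-α • A) T v
  set c := entrySum S * (Fintype.card ι : ℝ) ^ 2 with hc
  set f' : ℝ → ℝ := fun s => ((-α • A) *ᵥ w s) ⬝ᵥ H s *ᵥ w s + w s ⬝ᵥ H' s *ᵥ w s +
    w s ⬝ᵥ H s *ᵥ ((-α • A) *ᵥ w s) with hf'
  have hf : ∀ s ∈ Set.Icc 0 T,
      HasDerivWithinAt (fun s => w s ⬝ᵥ H s *ᵥ w s) (f' s) (Set.Icc 0 T) s := fun s hs =>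
    hasDerivWithinAt_quad (hd s hs) fun i => (hw s i).hasDerivWithinAt
  have hbound : ∀ s ∈ Set.Icc 0 T,
      α ^ 2 * (H s).trace * (w s ⬝ᵥ W *ᵥ w s) ≤ c * (w s ⬝ᵥ H s *ᵥ w s) + f' s := by
    intro s hs
    have hH := hps s hs
    have h1 := hsup s hs (w s)
    rw [quad_homField A S W α hH.transpose_eq] at h1
    have h2 := hH.quad_mulVec_le S (w s)
    have h3 : 1 / (H s).trace * ((H s *ᵥ w s) ⬝ᵥ S *ᵥ (H s *ᵥ w s)) ≤
        c * (w s ⬝ᵥ H s *ᵥ w s) := by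
      rcases hH.trace_nonneg.eq_or_lt with h | h
      · rw [hH.trace_eq_zero_iff.1 h.symm]; simp
      · rw [one_div_mul_eq_div, div_le_iff₀ h]
        linarith
    have h4 : f' s = w s ⬝ᵥ H' s *ᵥ w s - 2 * α * ((H s *ᵥ w s) ⬝ᵥ (A *ᵥ w s)) := by
      simp only [hf', smul_mulVec, smul_dotProduct, mulVec_smul, dotProduct_smul, smul_eq_mul,
        dotProduct_mulVec_of_symm hH.transpose_eq (w s), dotProduct_comm (A *ᵥ w s)]
      ring
    linarith
  have hWnn : ∀ s ∈ Set.Icc 0 T, 0 ≤ α ^ 2 * (H s).trace * (w s ⬝ᵥ W *ᵥ w s) := fun s hs =>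
    mul_nonneg (mul_nonneg (sq_nonneg _) (hps s hs).trace_nonneg) (hW.quad_nonneg _)
  set g : ℝ → ℝ := fun s => Real.exp (c * s) * (w s ⬝ᵥ H s *ᵥ w s) with hg
  have hgd : ∀ s ∈ Set.Icc 0 T, HasDerivWithinAt g
      (Real.exp (c * s) * (c * (w s ⬝ᵥ H s *ᵥ w s) + f' s)) (Set.Icc 0 T) s := by
    intro s hs
    have h1 : HasDerivAt (fun s => Real.exp (c * s)) (Real.exp (c * s) * (c * 1)) s :=
      ((hasDerivAt_id s).const_mul c).exp
    refine (h1.hasDerivWithinAt.mul (hf s hs)).congr_deriv ?_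
    ring
  have hgd' : ∀ s ∈ Set.Ioo 0 T, HasDerivAt g
      (Real.exp (c * s) * (c * (w s ⬝ᵥ H s *ᵥ w s) + f' s)) s := fun s hs =>
    (hgd s (Set.Ioo_subset_Icc_self hs)).hasDerivAt (Icc_mem_nhds hs.1 hs.2)
  have hmono : MonotoneOn g (Set.Icc 0 T) := by
    refine monotoneOn_of_deriv_nonneg (convex_Icc 0 T)
      (fun s hs => (hgd s hs).continuousWithinAt) ?_ ?_
    · rw [interior_Icc]
      exact fun s hs => (hgd' s hs).differentiableAt.differentiableWithinAt
    · rw [interior_Icc]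
      intro s hs
      rw [(hgd' s hs).deriv]
      have hs' := Set.Ioo_subset_Icc_self hs
      exact mul_nonneg (Real.exp_pos _).le ((hWnn s hs').trans (hbound s hs'))
  -- g is nonnegative, nondecreasing and zero at T. Its derivative, which dominates the W-term,
  -- therefore vanishes.
  have hg0 : ∀ s ∈ Set.Icc 0 T, g s = 0 := by
    intro s hs
    refine le_antisymm ((hmono hs hTm hs.2).trans_eq ?_)
      (mul_nonneg (Real.exp_pos _).le ((hps s hs).quad_nonneg _))
    simp only [hg, hwT, hv, dotProduct_zero, mul_zero]
  have hzero : ∀ s ∈ Set.Ioo 0 T, (H s).trace * (w s ⬝ᵥ W *ᵥ w s) = 0 := by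
    intro s hs
    have hs' := Set.Ioo_subset_Icc_self hs
    have h1 : HasDerivAt g 0 s := by
      refine (hasDerivAt_const s (0 : ℝ)).congr_of_eventuallyEq ?_
      filter_upwards [Ioo_mem_nhds hs.1 hs.2] with r hr
      exact hg0 r (Set.Ioo_subset_Icc_self hr)
    have h2 := (mul_eq_zero.1 ((hgd' s hs).unique h1)).resolve_left (Real.exp_ne_zero _)
    have h3 := hbound s hs'
    rw [h2] at h3
    have h4 := le_antisymm h3 (hWnn s hs')
    rw [mul_assoc] at h4
    exact (mul_eq_zero.1 h4).resolve_left (pow_ne_zero _ hα.ne')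
  have htr : ContinuousOn (fun s => (H s).trace) (Set.Icc 0 T) :=
    continuousOn_finsetSum _ fun i _ s hs => (hd s hs i i).continuousWithinAt
  have hpos : ∀ᶠ s in 𝓝[>] (0 : ℝ), 0 < (H s).trace :=
    ((htr 0 h0m).mono_of_mem_nhdsWithin (Icc_mem_nhdsGT hT)).eventually_const_lt
      ((hps 0 h0m).trace_pos h0)
  -- H 0 ≠ 0 keeps the trace positive only for a short time, but W w = 0 on a short interval is
  -- enough.
  obtain ⟨b, hb, hb'⟩ := (mem_nhdsGT_iff_exists_Ioo_subset' hT).1 hpos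
  have hbp : 0 < min b T := lt_min hb hT
  have hWw : ∀ s ∈ Set.Ioo 0 (min b T), W *ᵥ w s = 0 := by
    intro s hs
    refine hW.mulVec_eq_zero ((mul_eq_zero.1
      (hzero s ⟨hs.1, hs.2.trans_le (min_le_right _ _)⟩)).resolve_left ?_)
    exact (hb' ⟨hs.1, hs.2.trans_le (min_le_left _ _)⟩ : 0 < (H s).trace).ne'
  exact hw0 _ (eq_zero_of_linear_flow hα.ne' hobs hw hWw
    (s := min b T / 2) ⟨by linarith, by linarith⟩)

end MatrixCurves

/-! ### Local existence inside a ball -/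

section Picard

open ODE in
/-- The Picard–Lindelöf theorem, with the information that the solution stays in the ball on which
the field is controlled. -/
theorem IsPicardLindelof.exists_hasDerivWithinAt_mem_closedBall {E : Type*} [NormedAddCommGroup E]
    [NormedSpace ℝ E] [CompleteSpace E] {f : ℝ → E → E} {tmin tmax : ℝ} {t₀ : Set.Icc tmin tmax}
    {x₀ x : E} {a r L K : ℝ≥0} (hf : IsPicardLindelof f t₀ x₀ a r L K)
    (hx : x ∈ Metric.closedBall x₀ r) :
    ∃ α : ℝ → E, α t₀ = x ∧ ∀ t ∈ Set.Icc tmin tmax, α t ∈ Metric.closedBall x₀ a ∧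
      HasDerivWithinAt α (f t (α t)) (Set.Icc tmin tmax) t := by
  obtain ⟨α, hα⟩ := FunSpace.exists_isFixedPt_next hf hx
  refine ⟨α.compProj, by rw [FunSpace.compProj_val, ← hα, FunSpace.next_apply₀], fun t ht =>
    ⟨α.compProj_mem_closedBall hf.mul_max_le, ?_⟩⟩
  refine (hasDerivWithinAt_picard_Icc t₀.2 hf.continuousOn_uncurry
    α.continuous_compProj.continuousOn (fun _ ht' => α.compProj_mem_closedBall hf.mul_max_le)
    x ht).congr_of_mem (fun t' ht' => ?_) ht
  nth_rw 1 [← hα]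
  rw [FunSpace.compProj_of_mem ht', FunSpace.next_apply]

end Picard

/-! ### Entrywise and matrix derivatives -/

section Entries

open scoped Matrix.Norms.Elementwise

theorem hasDerivWithinAt_matrix_iff {ι : Type*} [Fintype ι] {Q : ℝ → Matrix ι ι ℝ}
    {Q' : Matrix ι ι ℝ} {s : Set ℝ} {t : ℝ} :
    HasDerivWithinAt Q Q' s t ↔
      ∀ i j, HasDerivWithinAt (fun s => Q s i j) (Q' i j) s t := by
  refine (hasDerivWithinAt_pi (φ := Q) (φ' := Q')).trans (forall_congr' fun i => ?_)
  exact hasDerivWithinAt_pi (φ := fun s => Q s i) (φ' := Q' i)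

end Entries

/-! ### The flow: uniqueness, comparison, global existence -/

section Flow

open scoped Matrix.Norms.Operator

variable {ι : Type*} [Fintype ι]

/-- `Q` solves the homogeneous Riccati equation on `[0, T]` in the half space of positive trace. -/
structure SolvesOn (A S W : Matrix ι ι ℝ) (α : ℝ) (Q : ℝ → Matrix ι ι ℝ) (T : ℝ) : Prop where
  trace_pos : ∀ t ∈ Set.Icc 0 T, 0 < (Q t).trace
  hasDeriv : ∀ t ∈ Set.Icc 0 T,
    HasDerivWithinAt Q (homField A S W α (Q t)) (Set.Icc 0 T) t

variable {A S W : Matrix ι ι ℝ} {α : ℝ}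

namespace SolvesOn

variable {Q Q' : ℝ → Matrix ι ι ℝ} {T : ℝ}

theorem continuousOn (h : SolvesOn A S W α Q T) : ContinuousOn Q (Set.Icc 0 T) :=
  fun t ht => (h.hasDeriv t ht).continuousWithinAt

theorem hasDeriv_entry (h : SolvesOn A S W α Q T) (t : ℝ) (ht : t ∈ Set.Icc 0 T) (i j : ι) :
    HasDerivWithinAt (fun s => Q s i j) (homField A S W α (Q t) i j) (Set.Icc 0 T) t :=
  hasDerivWithinAt_matrix_iff.1 (h.hasDeriv t ht) i j

theorem hasDeriv_right (h : SolvesOn A S W α Q T) (t : ℝ) (ht : t ∈ Set.Ico 0 T) :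
    HasDerivWithinAt Q (homField A S W α (Q t)) (Set.Ici t) t :=
  ((h.hasDeriv t ⟨ht.1, ht.2.le⟩).mono (Set.Icc_subset_Icc_left ht.1)).mono_of_mem_nhdsWithin
    (Icc_mem_nhdsGE ht.2)

theorem mono (h : SolvesOn A S W α Q T) {T' : ℝ} (hT : T' ≤ T) : SolvesOn A S W α Q T' where
  trace_pos t ht := h.trace_pos t ⟨ht.1, ht.2.trans hT⟩
  hasDeriv t ht := (h.hasDeriv t ⟨ht.1, ht.2.trans hT⟩).mono (Set.Icc_subset_Icc_right hT)

theorem congr (h : SolvesOn A S W α Q T) (hQ : Set.EqOn Q' Q (Set.Icc 0 T)) :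
    SolvesOn A S W α Q' T where
  trace_pos t ht := by rw [hQ ht]; exact h.trace_pos t ht
  hasDeriv t ht := by rw [hQ ht]; exact (h.hasDeriv t ht).congr_of_mem hQ ht

theorem shift (h : SolvesOn A S W α Q T) {a b : ℝ} (ha : 0 ≤ a) (hb : a + b ≤ T) :
    SolvesOn A S W α (fun t => Q (a + t)) b where
  trace_pos t ht := h.trace_pos _ ⟨by linarith [ht.1], by linarith [ht.2]⟩
  hasDeriv t ht := by
    have hm : Set.MapsTo (fun s => a + s) (Set.Icc 0 b) (Set.Icc 0 T) :=
      fun s hs => ⟨add_nonneg ha hs.1, (add_le_add_right hs.2 a).trans hb⟩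
    have hs : HasDerivWithinAt (fun s => a + s) 1 (Set.Icc 0 b) t :=
      (hasDerivWithinAt_id t _).const_add a
    have h1 := (h.hasDeriv (a + t) (hm ht)).scomp t hs hm
    rw [one_smul] at h1
    exact h1

theorem transpose (h : SolvesOn A S W α Q T) (hS : Sᵀ = S) (hW : Wᵀ = W) :
    SolvesOn A S W α (fun t => (Q t)ᵀ) T where
  trace_pos t ht := by rw [trace_transpose]; exact h.trace_pos t ht
  hasDeriv t ht := by
    rw [← homField_transpose hS hW]
    exact hasDerivWithinAt_matrix_iff.2 fun i j => h.hasDeriv_entry t ht j i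

theorem glue (h : SolvesOn A S W α Q T) {b : ℝ} (hT : 0 ≤ T) (hb : 0 ≤ b)
    (h' : SolvesOn A S W α Q' b) (h0 : Q' 0 = Q T) :
    SolvesOn A S W α (fun t => if t ≤ T then Q t else Q' (t - T)) (T + b) := by
  set R : ℝ → Matrix ι ι ℝ := fun t => if t ≤ T then Q t else Q' (t - T) with hR
  have hR1 : ∀ t ≤ T, R t = Q t := fun t ht => if_pos ht
  have hR2 : ∀ t, T ≤ t → R t = Q' (t - T) := by
    intro t ht
    rcases ht.eq_or_lt with rfl | ht
    · rw [hR1 _ le_rfl, sub_self, h0]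
    · exact if_neg (not_le.2 ht)
  have hd1 : ∀ t ∈ Set.Icc 0 T, HasDerivWithinAt R (homField A S W α (R t)) (Set.Icc 0 T) t := by
    intro t ht
    rw [hR1 t ht.2]
    exact (h.hasDeriv t ht).congr_of_mem (fun s hs => hR1 s hs.2) ht
  have hd2 : ∀ t ∈ Set.Icc T (T + b),
      HasDerivWithinAt R (homField A S W α (R t)) (Set.Icc T (T + b)) t := by
    intro t ht
    rw [hR2 t ht.1]
    have hm : Set.MapsTo (fun s => s - T) (Set.Icc T (T + b)) (Set.Icc 0 b) :=
      fun s hs => ⟨sub_nonneg.2 hs.1, sub_le_iff_le_add'.2 hs.2⟩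
    have hs : HasDerivWithinAt (fun s => s - T) 1 (Set.Icc T (T + b)) t :=
      (hasDerivWithinAt_id t _).sub_const T
    have h1 := (h'.hasDeriv (t - T) (hm ht)).scomp t hs hm
    rw [one_smul] at h1
    exact h1.congr_of_mem (fun s hs => hR2 s hs.1) ht
  have hunion : Set.Icc 0 (T + b) = Set.Icc 0 T ∪ Set.Icc T (T + b) :=
    (Set.Icc_union_Icc_eq_Icc hT (by linarith)).symm
  refine ⟨fun t ht => ?_, fun t ht => ?_⟩
  · rcases le_total t T with h1 | h1
    · rw [hR1 t h1]; exact h.trace_pos t ⟨ht.1, h1⟩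
    · rw [hR2 t h1]; exact h'.trace_pos _ ⟨by linarith, by linarith [ht.2]⟩
  · rcases lt_trichotomy t T with h1 | h1 | h1
    · refine (hd1 t ⟨ht.1, h1.le⟩).mono_of_mem_nhdsWithin ?_
      rw [mem_nhdsWithin]
      exact ⟨Set.Iio T, isOpen_Iio, h1, fun s hs => ⟨hs.2.1, le_of_lt hs.1⟩⟩
    · subst h1
      rw [hunion]
      exact (hd1 t ⟨ht.1, le_rfl⟩).union (hd2 t ⟨le_rfl, ht.2⟩)
    · refine (hd2 t ⟨h1.le, ht.2⟩).mono_of_mem_nhdsWithin ?_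
      rw [mem_nhdsWithin]
      exact ⟨Set.Ioi T, isOpen_Ioi, h1, fun s hs => ⟨le_of_lt hs.1, hs.2.2⟩⟩

end SolvesOn

variable [DecidableEq ι]

theorem contDiffOn_homField :
    ContDiffOn ℝ 1 (homField A S W α) {X : Matrix ι ι ℝ | X.trace ≠ 0} := by
  have htr : ContDiff ℝ 1 (trace : Matrix ι ι ℝ → ℝ) :=
    (LinearMap.toContinuousLinearMap (traceLinearMap ι ℝ ℝ)).contDiff
  have hid : ContDiff ℝ 1 (fun X : Matrix ι ι ℝ => X) := contDiff_id
  have h1 : ContDiff ℝ 1 (fun X : Matrix ι ι ℝ => α • (Aᵀ * X)) :=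
    (contDiff_const.mul hid).const_smul α
  have h2 : ContDiff ℝ 1 (fun X : Matrix ι ι ℝ => α • (X * A)) :=
    (hid.mul contDiff_const).const_smul α
  have h3 : ContDiff ℝ 1 (fun X : Matrix ι ι ℝ => X * S * X) :=
    (hid.mul contDiff_const).mul hid
  have h4 : ContDiff ℝ 1 (fun X : Matrix ι ι ℝ => (α ^ 2 * X.trace) • W) :=
    (contDiff_const.mul htr).smul contDiff_const
  have h5 : ContDiffOn ℝ 1 (fun X : Matrix ι ι ℝ => 1 / X.trace) {X | X.trace ≠ 0} :=
    contDiffOn_const.div htr.contDiffOn fun X hX => hX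
  exact (((h1.add h2).contDiffOn).sub (h5.smul h3.contDiffOn)).add h4.contDiffOn

theorem exists_lipschitzOnWith_homField (A S W : Matrix ι ι ℝ) (α : ℝ) {K : Set (Matrix ι ι ℝ)}
    (hK : IsCompact K) (hKc : Convex ℝ K) (hK0 : ∀ X ∈ K, 0 < X.trace) :
    ∃ k, LipschitzOnWith k (homField A S W α) K :=
  (contDiffOn_homField.mono fun X hX => (hK0 X hX).ne').exists_lipschitzOnWith one_ne_zero hKc hK

/-- For d > 0 these sets stay away from trace zero; being also convex, they carry a Lipschitz
constant of the C¹ field. -/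
theorem isCompact_closedBall_inter_trace (r d : ℝ) :
    IsCompact (Metric.closedBall (0 : Matrix ι ι ℝ) r ∩ {X | d ≤ X.trace}) :=
  (isCompact_closedBall _ _).inter_right (isClosed_le continuous_const (by fun_prop))

theorem convex_closedBall_inter_trace (r d : ℝ) :
    Convex ℝ (Metric.closedBall (0 : Matrix ι ι ℝ) r ∩ {X | d ≤ X.trace}) :=
  (convex_closedBall _ _).inter (convex_halfSpace_ge (traceLinearMap ι ℝ ℝ).isLinear d)

namespace SolvesOn

variable {Q Q' : ℝ → Matrix ι ι ℝ} {T : ℝ}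

theorem smul (h : SolvesOn A S W α Q T) {c : ℝ} (hc : 0 < c) :
    SolvesOn A S W α (fun t => c • Q t) T where
  trace_pos t ht := by rw [trace_smul]; exact mul_pos hc (h.trace_pos t ht)
  hasDeriv t ht := by rw [homField_smul c hc.ne']; exact (h.hasDeriv t ht).const_smul c

theorem exists_mem (h : SolvesOn A S W α Q T) :
    ∃ r d : ℝ, 0 < d ∧
      ∀ t ∈ Set.Icc 0 T, Q t ∈ Metric.closedBall (0 : Matrix ι ι ℝ) r ∩ {X | d ≤ X.trace} := by
  rcases lt_or_ge T 0 with hT | hT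
  · exact ⟨0, 1, one_pos, fun t ht => absurd (ht.1.trans ht.2) (not_le.2 hT)⟩
  obtain ⟨r, hr⟩ := isCompact_Icc.exists_bound_of_continuousOn h.continuousOn
  obtain ⟨s, hs, hmin⟩ := isCompact_Icc.exists_isMinOn (f := fun t => (Q t).trace)
    ⟨0, le_rfl, hT⟩ ((continuous_id.matrix_trace).comp_continuousOn h.continuousOn)
  exact ⟨r, (Q s).trace, h.trace_pos s hs, fun t ht => ⟨by simpa using hr t ht, hmin ht⟩⟩

theorem eqOn (h : SolvesOn A S W α Q T) (h' : SolvesOn A S W α Q' T) (h0 : Q 0 = Q' 0) :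
    Set.EqOn Q Q' (Set.Icc 0 T) := by
  obtain ⟨r, d, hd, hr⟩ := h.exists_mem
  obtain ⟨r', d', hd', hr'⟩ := h'.exists_mem
  obtain ⟨k, hk⟩ := exists_lipschitzOnWith_homField A S W α
    (isCompact_closedBall_inter_trace (max r r') (min d d'))
    (convex_closedBall_inter_trace _ _) fun X hX => (lt_min hd hd').trans_le hX.2
  refine ODE_solution_unique_of_mem_Icc_right (v := fun _ => homField A S W α)
    (s := fun _ => Metric.closedBall (0 : Matrix ι ι ℝ) (max r r') ∩ {X | min d d' ≤ X.trace})
    (K := k) (fun _ _ => hk) h.continuousOn h.hasDeriv_right (fun t ht => ?_) h'.continuousOn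
    h'.hasDeriv_right (fun t ht => ?_) h0
  · have := hr t (Set.Ico_subset_Icc_self ht)
    exact ⟨Metric.closedBall_subset_closedBall (le_max_left _ _) this.1,
      le_trans (α := ℝ) (min_le_left _ _) this.2⟩
  · have := hr' t (Set.Ico_subset_Icc_self ht)
    exact ⟨Metric.closedBall_subset_closedBall (le_max_right _ _) this.1,
      le_trans (α := ℝ) (min_le_right _ _) this.2⟩

theorem transpose_eq (h : SolvesOn A S W α Q T) (hS : Sᵀ = S) (hW : Wᵀ = W) (h0 : (Q 0)ᵀ = Q 0)
    (t : ℝ) (ht : t ∈ Set.Icc 0 T) : (Q t)ᵀ = Q t :=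
  (h.transpose hS hW).eqOn h h0 ht

section Comparison

variable {Z : ℝ → Matrix ι ι ℝ}

/-- Order preservation: a solution stays above a solution, or above the zero curve, if it starts
above it. -/
theorem posSemidef_sub (h : SolvesOn A S W α Q T) (hS : S.PosSemidef) (hW : W.PosSemidef)
    (hQ0 : (Q 0)ᵀ = Q 0) (hZs : ∀ t ∈ Set.Icc 0 T, (Z t)ᵀ = Z t)
    (hZ0 : ∀ t ∈ Set.Icc 0 T, 0 ≤ (Z t).trace)
    (hZ1 : ∀ t ∈ Set.Icc 0 T, (Z t).trace = 0 → Z t = 0)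
    (hZ : ∀ t ∈ Set.Icc 0 T, HasDerivWithinAt Z (homField A S W α (Z t)) (Set.Icc 0 T) t)
    (h0 : (Q 0 - Z 0).PosSemidef) (t : ℝ) (ht : t ∈ Set.Icc 0 T) : (Q t - Z t).PosSemidef := by
  -- The matrix in `homField_quasimonotone` depends on Q but not on Z. It is continuous on a compact
  -- interval, so a single rate k suffices.
  set M : ℝ → Matrix ι ι ℝ := fun t => (2 * α) • A - (2 / (Q t).trace) • (S * Q t) +
    ((Fintype.card ι : ℝ) / (Q t).trace ^ 2) • (Q t * S * Q t) +
    ((Fintype.card ι : ℝ) * α ^ 2) • W with hM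
  have hQc := h.continuousOn
  have htrc : ContinuousOn (fun t => (Q t).trace) (Set.Icc 0 T) :=
    (continuous_id.matrix_trace).comp_continuousOn hQc
  have hMc : ContinuousOn M (Set.Icc 0 T) := by
    have h1 : ContinuousOn (fun t => S * Q t) (Set.Icc 0 T) :=
      (by fun_prop : Continuous fun X : Matrix ι ι ℝ => S * X).comp_continuousOn hQc
    have h2 : ContinuousOn (fun t => Q t * S * Q t) (Set.Icc 0 T) :=
      (by fun_prop : Continuous fun X : Matrix ι ι ℝ => X * S * X).comp_continuousOn hQc
    have h3 : ContinuousOn (fun t => 2 / (Q t).trace) (Set.Icc 0 T) :=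
      continuousOn_const.div htrc fun s hs => (h.trace_pos s hs).ne'
    have h4 : ContinuousOn (fun t => (Fintype.card ι : ℝ) / (Q t).trace ^ 2) (Set.Icc 0 T) :=
      continuousOn_const.div (htrc.pow 2) fun s hs => pow_ne_zero _ (h.trace_pos s hs).ne'
    exact ((continuousOn_const.sub (h3.smul h1)).add (h4.smul h2)).add continuousOn_const
  obtain ⟨k, hk⟩ := isCompact_Icc.exists_bound_of_continuousOn
    (continuous_entrySum.comp_continuousOn hMc)
  refine posSemidef_of_quasimonotone (H := fun t => Q t - Z t)
    (H' := fun t => homField A S W α (Q t) - homField A S W α (Z t)) (k := k)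
    (fun s hs i j => (h.hasDeriv_entry s hs i j).sub (hasDerivWithinAt_matrix_iff.1 (hZ s hs) i j))
    (fun s hs => ?_) h0 (fun s hs e he v hv hte => ?_) t ht
  · rw [transpose_sub, hZs s hs, h.transpose_eq hS.transpose_eq hW.transpose_eq hQ0 s hs]
  · have h1 := homField_quasimonotone (α := α) (A := A) hS hW
      (h.transpose_eq hS.transpose_eq hW.transpose_eq hQ0 s hs) (hZs s hs) (h.trace_pos s hs)
      (hZ0 s hs) (hZ1 s hs) he hv hte
    refine le_trans ?_ h1
    have h2 : entrySum (M s) ≤ k := (le_abs_self _).trans (hk s hs)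
    have h3 := mul_le_mul_of_nonneg_right (mul_le_mul_of_nonneg_right h2 he.le)
      (dotProduct_self_nonneg' v)
    linarith

/-- Strong order preservation. -/
theorem posDef_sub (h : SolvesOn A S W α Q T) (hα : 0 < α)
    (hobs : ∀ v, (∀ k : ℕ, W *ᵥ (A ^ k *ᵥ v) = 0) → v = 0) (hS : S.PosSemidef)
    (hW : W.PosSemidef)
    (hQ0 : (Q 0)ᵀ = Q 0) (hZs : ∀ t ∈ Set.Icc 0 T, (Z t)ᵀ = Z t)
    (hZ0 : ∀ t ∈ Set.Icc 0 T, 0 ≤ (Z t).trace)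
    (hZ1 : ∀ t ∈ Set.Icc 0 T, (Z t).trace = 0 → Z t = 0)
    (hZ : ∀ t ∈ Set.Icc 0 T, HasDerivWithinAt Z (homField A S W α (Z t)) (Set.Icc 0 T) t)
    (h0 : (Q 0 - Z 0).PosSemidef) (hne : Q 0 ≠ Z 0) (hT : 0 < T) : (Q T - Z T).PosDef := by
  have hps := h.posSemidef_sub hS hW hQ0 hZs hZ0 hZ1 hZ h0
  refine posDef_of_supersolution (S := S) hα hobs hW (H := fun t => Q t - Z t)
    (H' := fun t => homField A S W α (Q t) - homField A S W α (Z t)) hT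
    (fun s hs i j => (h.hasDeriv_entry s hs i j).sub (hasDerivWithinAt_matrix_iff.1 (hZ s hs) i j))
    hps (sub_ne_zero.2 hne) fun s hs v => ?_
  -- Superadditivity makes Q - Z a supersolution of the homogeneous equation.
  have := homField_superadditive (A := A) (W := W) (α := α) hS (hZs s hs) (hps s hs)
    (hZ0 s hs) (hZ1 s hs) v
  rw [sub_mulVec, dotProduct_sub]
  linarith

/-- Comparison with the zero curve. Its trace is not positive, which is why the comparison lemmas do
not require `SolvesOn` for Z. -/
theorem posSemidef (h : SolvesOn A S W α Q T) (hS : S.PosSemidef) (hW : W.PosSemidef)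
    (h0 : (Q 0).PosSemidef) (t : ℝ) (ht : t ∈ Set.Icc 0 T) : (Q t).PosSemidef := by
  have := h.posSemidef_sub hS hW h0.transpose_eq (Z := fun _ => 0) (by simp) (by simp) (by simp)
    (fun s _ => by rw [homField_zero]; exact hasDerivWithinAt_const _ _ _) (by simpa using h0) t ht
  simpa using this

theorem posDef (h : SolvesOn A S W α Q T) (hα : 0 < α)
    (hobs : ∀ v, (∀ k : ℕ, W *ᵥ (A ^ k *ᵥ v) = 0) → v = 0) (hS : S.PosSemidef)
    (hW : W.PosSemidef) (h0 : (Q 0).PosSemidef) (hT : 0 < T) : (Q T).PosDef := by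
  have hne : Q 0 ≠ 0 := by
    intro h1
    simpa [h1] using h.trace_pos 0 ⟨le_rfl, hT.le⟩
  have := h.posDef_sub hα hobs hS hW h0.transpose_eq (Z := fun _ => 0) (by simp) (by simp) (by simp)
    (fun s _ => by rw [homField_zero]; exact hasDerivWithinAt_const _ _ _) (by simpa using h0)
    hne hT
  simpa using this

end Comparison

end SolvesOn

/-- The trace-one slice is compact, so one radius, bound and Lipschitz constant work for all its
points. Homogeneity will carry the same existence time to the whole cone. -/
theorem exists_solvesOn_uniform (A S W : Matrix ι ι ℝ) (α : ℝ) :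
    ∃ ε : ℝ, 0 < ε ∧ ∀ X : Matrix ι ι ℝ, X.PosSemidef → X.trace = 1 →
      ∃ Q, Q 0 = X ∧ SolvesOn A S W α Q ε := by
  have hslice : IsCompact {X : Matrix ι ι ℝ | X.PosSemidef ∧ X.trace = 1} :=
    isCompact_of_posSemidef_of_trace_le
      (isClosed_setOf_posSemidef.inter (isClosed_eq (by fun_prop) continuous_const)) 1
      fun X hX => ⟨hX.1, hX.2.le⟩
  obtain ⟨r, hr⟩ := hslice.exists_bound_of_continuousOn continuousOn_id
  obtain ⟨a', ha', htr⟩ : ∃ a' > 0, ∀ Y : Matrix ι ι ℝ, ‖Y‖ < a' → |Y.trace| < 1 / 2 := by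
    have h1 : Continuous (trace : Matrix ι ι ℝ → ℝ) := by fun_prop
    obtain ⟨a', ha', h2⟩ := Metric.continuousAt_iff.1 (h1.continuousAt (x := 0)) (1 / 2)
      one_half_pos
    exact ⟨a', ha', fun Y hY => by
      simpa using h2 (x := Y) (by rwa [dist_zero_right])⟩
  set a : ℝ≥0 := ⟨a' / 2, by positivity⟩ with ha
  have ha0 : (0 : ℝ) < a := half_pos ha'
  have haa : (a : ℝ) < a' := half_lt_self ha'
  set K := Metric.closedBall (0 : Matrix ι ι ℝ) (r + a) ∩ {X | 1 / 2 ≤ X.trace} with hK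
  have hKc : IsCompact K := isCompact_closedBall_inter_trace _ _
  have hK0 : ∀ X ∈ K, 0 < X.trace := fun X hX => one_half_pos.trans_le hX.2
  obtain ⟨k, hk⟩ := exists_lipschitzOnWith_homField A S W α hKc
    (convex_closedBall_inter_trace _ _) hK0
  obtain ⟨L, hL⟩ := hKc.exists_bound_of_continuousOn hk.continuousOn
  set L' : ℝ≥0 := ⟨max L 0 + 1, by positivity⟩ with hL'
  have hL'0 : (0 : ℝ) < L' := by change (0 : ℝ) < max L 0 + 1; positivity
  have hLL' : L ≤ L' := by
    change L ≤ max L 0 + 1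
    linarith [le_max_left L 0]
  have hε : (0 : ℝ) < a / L' := div_pos ha0 hL'0
  -- At speed at most L' a solution stays within distance a of X for time a / L', and within that
  -- distance the trace stays at least 1/2.
  refine ⟨a / L', hε, fun X hX hX1 => ?_⟩
  have hball : Metric.closedBall X a ⊆ K := by
    intro Y hY
    rw [mem_closedBall_iff_norm] at hY
    constructor
    · rw [mem_closedBall_zero_iff]
      have h1 : ‖X‖ ≤ r := hr X ⟨hX, hX1⟩
      have h2 : ‖Y‖ ≤ ‖Y - X‖ + ‖X‖ := by simpa using norm_add_le (Y - X) X
      linarith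
    · have h1 := (abs_lt.1 (htr _ (hY.trans_lt haa))).1
      rw [trace_sub, hX1] at h1
      change 1 / 2 ≤ Y.trace
      linarith
  have hPL : IsPicardLindelof (fun _ => homField A S W α) (tmin := 0) (tmax := a / L')
      ⟨0, le_rfl, hε.le⟩ X a 0 L' k := by
    refine IsPicardLindelof.of_time_independent (fun Y hY => (hL Y (hball hY)).trans hLL')
      (hk.mono hball) ?_
    simp only [sub_zero, max_eq_left hε.le, NNReal.coe_zero]
    rw [mul_div_cancel₀ _ hL'0.ne']
  obtain ⟨Q, hQ0, hQ⟩ := hPL.exists_hasDerivWithinAt_mem_closedBall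
    (Metric.mem_closedBall_self le_rfl)
  exact ⟨Q, hQ0, fun t ht => hK0 _ (hball (hQ t ht).1), fun t ht => (hQ t ht).2⟩

/-- After rescaling to trace one every restart lasts for the same ε. Cone invariance permits the
restart, so steps of length ε can be glued without end. -/
theorem exists_solvesOn (α : ℝ) (hS : S.PosSemidef) (hW : W.PosSemidef) {X : Matrix ι ι ℝ}
    (hX : X.PosSemidef) (hX0 : X ≠ 0) :
    ∃ Q : ℝ → Matrix ι ι ℝ, Q 0 = X ∧ ∀ T, SolvesOn A S W α Q T := by
  obtain ⟨ε, hε, hloc⟩ := exists_solvesOn_uniform A S W α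
  have hloc' : ∀ Y : Matrix ι ι ℝ, Y.PosSemidef → 0 < Y.trace →
      ∃ Q, Q 0 = Y ∧ SolvesOn A S W α Q ε := by
    intro Y hY hY0
    obtain ⟨Q, hQ0, hQ⟩ := hloc (Y.trace⁻¹ • Y) (hY.smul (inv_nonneg.2 hY0.le))
      (by rw [trace_smul, smul_eq_mul, inv_mul_cancel₀ hY0.ne'])
    refine ⟨_, ?_, hQ.smul hY0⟩
    simp only [hQ0]
    rw [smul_smul, mul_inv_cancel₀ hY0.ne', one_smul]
  have hstep : ∀ k : ℕ, ∃ Q : ℝ → Matrix ι ι ℝ, Q 0 = X ∧ SolvesOn A S W α Q (k * ε) := by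
    intro k
    induction k with
    | zero =>
      obtain ⟨Q, hQ0, hQ⟩ := hloc' X hX (hX.trace_pos hX0)
      exact ⟨Q, hQ0, hQ.mono (by simpa using hε.le)⟩
    | succ k ih =>
      obtain ⟨Q, hQ0, hQ⟩ := ih
      have hkε : 0 ≤ (k : ℝ) * ε := by positivity
      have hmem : (k : ℝ) * ε ∈ Set.Icc 0 ((k : ℝ) * ε) := ⟨hkε, le_rfl⟩
      obtain ⟨Q', hQ'0, hQ'⟩ := hloc' _ (hQ.posSemidef hS hW (hQ0 ▸ hX) _ hmem)
        (hQ.trace_pos _ hmem)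
      have := hQ.glue hkε hε.le hQ' hQ'0
      refine ⟨_, ?_, by convert this using 1; push_cast; ring⟩
      simp only [if_pos hkε, hQ0]
  choose Q hQ0 hQ using hstep
  have hagree : ∀ k l : ℕ, ∀ t ∈ Set.Icc 0 (k * ε), t ≤ l * ε → Q k t = Q l t := by
    intro k l t ht htl
    exact ((hQ k).mono ht.2).eqOn ((hQ l).mono htl) ((hQ0 k).trans (hQ0 l).symm) ⟨ht.1, le_rfl⟩
  have hceil : ∀ t : ℝ, t ≤ (⌈t / ε⌉₊ : ℝ) * ε := fun t => (div_le_iff₀ hε).1 (Nat.le_ceil _)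
  -- At time t use any piece that reaches t; uniqueness makes the pieces agree.
  refine ⟨fun t => Q ⌈t / ε⌉₊ t, by simp [hQ0], fun T => ?_⟩
  refine ((hQ ⌈T / ε⌉₊).mono (hceil T)).congr fun t ht => ?_
  exact hagree _ _ t ⟨ht.1, hceil t⟩ (ht.2.trans (hceil T))

end Flow

/-! ### Convergence to the equilibrium ray -/

section Convergence

theorem solvesOn_const {ι : Type*} [Fintype ι] [Nonempty ι] {A S W P : Matrix ι ι ℝ} {α : ℝ}
    (hP : P.PosDef) (hP0 : homField A S W α P = 0) {c : ℝ} (hc : 0 < c) (T : ℝ) :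
    SolvesOn A S W α (fun _ => c • P) T where
  trace_pos _ _ := by rw [trace_smul]; exact mul_pos hc hP.trace_pos'
  hasDeriv _ _ := by
    rw [homField_smul c hc.ne', hP0, smul_zero]
    exact hasDerivWithinAt_matrix_iff.2 fun _ _ => hasDerivWithinAt_const _ _ _

variable {ι : Type*} [Fintype ι] [DecidableEq ι]

theorem Matrix.PosDef.eventually_posSemidef {β : Type*} {l : Filter β} {M : Matrix ι ι ℝ}
    (hM : M.PosDef) {f : β → Matrix ι ι ℝ} (hf : Tendsto f l (𝓝 M)) (hs : ∀ b, (f b)ᵀ = f b) :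
    ∀ᶠ b in l, (f b).PosSemidef := by
  obtain ⟨c, hc, hcM⟩ := hM.exists_pos_smul_le (PosDef.one (n := ι) (R := ℝ))
  have h1 : Tendsto (fun b => entrySum (f b - M)) l (𝓝 (entrySum (0 : Matrix ι ι ℝ))) := by
    refine (continuous_entrySum.tendsto 0).comp ?_
    simpa using hf.sub_const M
  filter_upwards [h1.eventually_lt_const (show entrySum (0 : Matrix ι ι ℝ) < c by
    simpa [entrySum] using hc)] with b hb
  refine posSemidef_of_quad (hs b) fun v => ?_
  have h2 := hcM.quad_nonneg v
  have h3 := (abs_le.1 (abs_quad_le (f b - M) v)).1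
  have h4 := mul_le_mul_of_nonneg_right hb.le (dotProduct_self_nonneg' v)
  simp only [sub_mulVec, smul_mulVec, one_mulVec, dotProduct_sub, dotProduct_smul,
    smul_eq_mul] at h2 h3
  linarith

variable {A S W P : Matrix ι ι ℝ} {α : ℝ} {Q : ℝ → Matrix ι ι ℝ}

section Invariance

variable (hS : S.PosSemidef) (hW : W.PosSemidef) (hP : P.PosDef) (hP0 : homField A S W α P = 0)
  (hQ : ∀ T, SolvesOn A S W α Q T)

include hS hW hP hP0 hQ in
-- aP is an equilibrium, so order preservation keeps Q above it.
theorem posSemidef_sub_const [Nonempty ι] {a s t : ℝ} (ha : 0 < a) (hs : 0 ≤ s) (hst : s ≤ t)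
    (hQs : (Q s)ᵀ = Q s) (h : (Q s - a • P).PosSemidef) : (Q t - a • P).PosSemidef := by
  have hc := solvesOn_const hP hP0 ha (t - s)
  have h1 := ((hQ t).shift hs (b := t - s) (by linarith)).posSemidef_sub hS hW
    (Z := fun _ => a • P) (by simpa using hQs)
    (fun _ _ => by rw [transpose_smul, hP.posSemidef.transpose_eq])
    (fun r hr => (hc.trace_pos r hr).le) (fun r hr h0 => absurd h0 (hc.trace_pos r hr).ne')
    hc.hasDeriv (by simpa using h) (t - s) ⟨by linarith, le_rfl⟩
  simpa using h1

include hS hW hP hP0 hQ in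
theorem posSemidef_const_sub [Nonempty ι] {b s t : ℝ} (hb : 0 < b) (hs : 0 ≤ s) (hst : s ≤ t)
    (hQs : (Q s)ᵀ = Q s) (h : (b • P - Q s).PosSemidef) : (b • P - Q t).PosSemidef := by
  have hc := solvesOn_const hP hP0 hb (t - s)
  have hsh := (hQ t).shift hs (b := t - s) (by linarith)
  have h1 := hc.posSemidef_sub hS hW (by rw [transpose_smul, hP.posSemidef.transpose_eq])
    (hsh.transpose_eq hS.transpose_eq hW.transpose_eq (by simpa using hQs))
    (fun r hr => (hsh.trace_pos r hr).le) (fun r hr h0 => absurd h0 (hsh.trace_pos r hr).ne')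
    hsh.hasDeriv (by simpa using h) (t - s) ⟨by linarith, le_rfl⟩
  simpa using h1

end Invariance

open scoped Matrix.Norms.Operator in
/-- Continuous dependence on the initial value inside an order interval around the equilibrium. -/
theorem tendsto_of_mem_orderInterval {X : Matrix ι ι ℝ} {Q' : ℕ → ℝ → Matrix ι ι ℝ}
    {K : Set (Matrix ι ι ℝ)} (hK : IsCompact K) (hKc : Convex ℝ K) (hK0 : ∀ X ∈ K, 0 < X.trace)
    (hQ : SolvesOn A S W α Q 1) (hQ' : ∀ k, SolvesOn A S W α (Q' k) 1)
    (hQK : ∀ t ∈ Set.Icc 0 1, Q t ∈ K) (hQK' : ∀ k, ∀ t ∈ Set.Icc 0 1, Q' k t ∈ K)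
    (hX : Q 0 = X) (h0 : Tendsto (fun k => Q' k 0) atTop (𝓝 X)) :
    Tendsto (fun k => Q' k 1) atTop (𝓝 (Q 1)) := by
  obtain ⟨L, hL⟩ := exists_lipschitzOnWith_homField A S W α hK hKc hK0
  have hdist : ∀ k, dist (Q' k 1) (Q 1) ≤ dist (Q' k 0) (Q 0) * Real.exp (L * (1 - 0)) :=
    fun k => dist_le_of_trajectories_ODE_of_mem (v := fun _ => homField A S W α)
      (s := fun _ => K) (K := L) (fun _ _ => hL) (hQ' k).continuousOn (hQ' k).hasDeriv_right
      (fun t ht => hQK' k t (Set.Ico_subset_Icc_self ht)) hQ.continuousOn hQ.hasDeriv_right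
      (fun t ht => hQK t (Set.Ico_subset_Icc_self ht)) le_rfl 1 ⟨zero_le_one, le_rfl⟩
  subst hX
  refine tendsto_iff_dist_tendsto_zero.2 (squeeze_zero (fun _ => dist_nonneg) hdist ?_)
  simpa using (tendsto_iff_dist_tendsto_zero.1 h0).mul_const (Real.exp (L * (1 - 0)))

/-- Every solution in the cone approaches the ray of a positive definite equilibrium. -/
theorem exists_orderInterval_of_solvesOn [Nonempty ι] (hα : 0 < α)
    (hobs : ∀ v, (∀ k : ℕ, W *ᵥ (A ^ k *ᵥ v) = 0) → v = 0) (hS : S.PosSemidef)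
    (hW : W.PosSemidef) (hP : P.PosDef) (hP0 : homField A S W α P = 0)
    (hQ : ∀ T, SolvesOn A S W α Q T) (hQ0 : (Q 0).PosSemidef) {ε : ℝ} (hε : 0 < ε)
    (hε1 : ε < 1) :
    ∃ c t₀ : ℝ, 0 < c ∧ 0 ≤ t₀ ∧ ∀ t, t₀ ≤ t → (Q t - ((1 - ε) * c) • P).PosSemidef ∧
      (((1 + ε) * c) • P - Q t).PosSemidef := by
  have hPt := hP.posSemidef.transpose_eq
  have htP := hP.trace_pos'
  have hQs : ∀ t, 0 ≤ t → (Q t)ᵀ = Q t := fun t ht =>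
    (hQ t).transpose_eq hS.transpose_eq hW.transpose_eq hQ0.transpose_eq t ⟨ht, le_rfl⟩
  have hQ1 : (Q 1).PosDef := (hQ 1).posDef hα hobs hS hW hQ0 one_pos
  obtain ⟨a₀, ha₀, hQa⟩ := hQ1.exists_pos_smul_le hP
  obtain ⟨d, hd, hPd⟩ := hP.exists_pos_smul_le hQ1
  set b₀ := d⁻¹
  have hb₀ : 0 < b₀ := inv_pos.2 hd
  have hQb : (b₀ • P - Q 1).PosSemidef := by
    have := hPd.smul hb₀.le
    rwa [smul_sub, smul_smul, inv_mul_cancel₀ hd.ne', one_smul] at this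
  have hpos : ∀ k : ℕ, (0 : ℝ) ≤ 1 + k := fun k => by positivity
  have hone : ∀ k : ℕ, (1 : ℝ) ≤ 1 + k := fun k => by simp
  -- Q 1 is positive definite, hence lies between two multiples of P. From then on the trajectory
  -- stays in this compact convex order interval, on which the trace is positive.
  set K : Set (Matrix ι ι ℝ) := {X | (X - a₀ • P).PosSemidef ∧ (b₀ • P - X).PosSemidef} with hK
  have hKQ : ∀ t, 1 ≤ t → Q t ∈ K := fun t ht =>
    ⟨posSemidef_sub_const hS hW hP hP0 hQ ha₀ zero_le_one ht hQ1.posSemidef.transpose_eq hQa,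
      posSemidef_const_sub hS hW hP hP0 hQ hb₀ zero_le_one ht hQ1.posSemidef.transpose_eq hQb⟩
  have hKps : ∀ X ∈ K, X.PosSemidef := fun X hX => by
    simpa using hX.1.add (hP.posSemidef.smul ha₀.le)
  have hKtr : ∀ X ∈ K, 0 < X.trace := fun X hX => by
    have := hX.1.trace_nonneg
    rw [trace_sub, trace_smul, smul_eq_mul] at this
    have := mul_pos ha₀ htP
    linarith
  have hKclosed : IsClosed K :=
    (isClosed_setOf_posSemidef.preimage (continuous_id.sub continuous_const)).inter
      (isClosed_setOf_posSemidef.preimage (continuous_const.sub continuous_id))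
  have hKc : IsCompact K := isCompact_of_posSemidef_of_trace_le hKclosed (b₀ * P.trace)
    fun X hX => ⟨hKps X hX, by
      have := hX.2.trace_nonneg
      rw [trace_sub, trace_smul, smul_eq_mul] at this
      linarith⟩
  have hKconv : Convex ℝ K := by
    intro X hX Y hY s t hs ht hst
    constructor
    · have := (hX.1.smul hs).add (hY.1.smul ht)
      rw [smul_sub, smul_sub] at this
      convert this using 1
      rw [sub_add_sub_comm, ← add_smul, hst, one_smul]
    · have := (hX.2.smul hs).add (hY.2.smul ht)
      rw [smul_sub, smul_sub] at this
      convert this using 1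
      rw [sub_add_sub_comm, ← add_smul, hst, one_smul]
  set R : ℕ → Matrix ι ι ℝ := fun k => Q (1 + k) with hR
  have : FirstCountableTopology (Matrix ι ι ℝ) :=
    inferInstanceAs (FirstCountableTopology (ι → ι → ℝ))
  obtain ⟨X, hXK, φ, hφ, hlim⟩ := hKc.tendsto_subseq fun k => hKQ (1 + (k : ℝ)) (hone k)
  -- A lower bound aP with a > 0 persists once attained, so sup E is the limit of the best lower
  -- constants.
  set E : Set ℝ := {a | ∃ k, (R k - a • P).PosSemidef} with hE
  have hEa₀ : a₀ ∈ E := ⟨0, by simpa [hR] using hQa⟩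
  have hEbdd : BddAbove E := by
    refine ⟨b₀, ?_⟩
    rintro a ⟨k, hk⟩
    have h1 := (hk.add (hKQ (1 + (k : ℝ)) (hone k)).2).trace_nonneg
    have h2 : R k - a • P + (b₀ • P - Q (1 + (k : ℝ))) = (b₀ - a) • P := by
      simp only [hR]; module
    rw [h2, trace_smul, smul_eq_mul] at h1
    linarith [nonneg_of_mul_nonneg_left h1 htP]
  set c := sSup E with hc
  have hc0 : 0 < c := ha₀.trans_le (le_csSup hEbdd hEa₀)
  have hXc : (X - c • P).PosSemidef := by
    have hcl : IsClosed {a : ℝ | (X - a • P).PosSemidef} :=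
      isClosed_setOf_posSemidef.preimage (by fun_prop : Continuous fun a : ℝ => X - a • P)
    have hsub : Set.Ioo 0 c ⊆ {a : ℝ | (X - a • P).PosSemidef} := by
      intro a ha
      obtain ⟨a', ⟨k, hk⟩, haa'⟩ := exists_lt_of_lt_csSup ⟨a₀, hEa₀⟩ ha.2
      have hka : (Q (1 + (k : ℝ)) - a • P).PosSemidef := by
        have := hk.add (hP.posSemidef.smul (sub_nonneg.2 haa'.le))
        convert this using 1
        simp only [hR]; module
      refine isClosed_setOf_posSemidef.mem_of_tendsto (hlim.sub_const (a • P)) ?_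
      filter_upwards [eventually_ge_atTop k] with j hj
      refine posSemidef_sub_const hS hW hP hP0 hQ ha.1 (hpos k) ?_ (hQs _ (hpos k)) hka
      have : (k : ℝ) ≤ φ j := by exact_mod_cast hj.trans (hφ.id_le j)
      simpa using this
    have := hcl.closure_subset_iff.2 hsub
    rw [closure_Ioo hc0.ne] at this
    exact this ⟨hc0.le, le_rfl⟩
  have hXeq : X = c • P := by
    by_contra hne
    have hXps := hKps X hXK
    obtain ⟨Y, hY0, hY⟩ := exists_solvesOn (A := A) α hS hW hXps (fun h0 => by
      have := hKtr X hXK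
      rw [h0, trace_zero] at this
      exact lt_irrefl _ this)
    have hconst := solvesOn_const hP hP0 hc0 1
    have hYpd : (Y 1 - c • P).PosDef := (hY 1).posDef_sub hα hobs hS hW (Z := fun _ => c • P)
      (by rw [hY0]; exact hXps.transpose_eq)
      (fun _ _ => by rw [transpose_smul, hPt]) (fun r hr => (hconst.trace_pos r hr).le)
      (fun r hr h0 => absurd h0 (hconst.trace_pos r hr).ne') hconst.hasDeriv
      (by rw [hY0]; exact hXc) (by rw [hY0]; exact hne) one_pos
    obtain ⟨δ, hδ, hYδ⟩ := hYpd.exists_pos_smul_le hP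
    -- Giving up half of δ leaves a positive definite gap, which survives small perturbations.
    have hYδ' : (Y 1 - (c + δ / 2) • P).PosDef := by
      have := PosDef.posSemidef_add hYδ (hP.smul (half_pos hδ))
      convert this using 1
      module
    have hYK : ∀ t ∈ Set.Icc (0 : ℝ) 1, Y t ∈ K := fun t ht =>
      ⟨posSemidef_sub_const hS hW hP hP0 hY ha₀ le_rfl ht.1 (by rw [hY0]; exact hXps.transpose_eq)
        (by rw [hY0]; exact hXK.1),
        posSemidef_const_sub hS hW hP hP0 hY hb₀ le_rfl ht.1
          (by rw [hY0]; exact hXps.transpose_eq) (by rw [hY0]; exact hXK.2)⟩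
    have hdep := tendsto_of_mem_orderInterval (Q' := fun j t => Q (1 + (φ j : ℝ) + t)) hKc hKconv
      hKtr (hY 1) (fun j => (hQ (1 + (φ j : ℝ) + 1)).shift (hpos _) le_rfl) hYK
      (fun j t ht => hKQ _ (by linarith [hone (φ j), ht.1])) hY0
      (by simpa [Function.comp_def] using hlim)
    obtain ⟨j, hj⟩ := (hYδ'.eventually_posSemidef (hdep.sub_const ((c + δ / 2) • P)) (fun j => by
      rw [transpose_sub, transpose_smul, hPt, hQs _ (by linarith [hpos (φ j)])])).exists
    -- R k samples Q at time 1 + k; flowing for one unit from index φ j lands at index φ j + 1.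
    have : c + δ / 2 ≤ c := le_csSup hEbdd ⟨φ j + 1, by
      simp only [hR]
      push_cast
      rw [← add_assoc]
      exact hj⟩
    linarith
  rw [hXeq] at hlim
  have hlow : ∀ᶠ j in atTop, (Q (1 + (φ j : ℝ)) - ((1 - ε) * c) • P).PosSemidef := by
    have hpd : (c • P - ((1 - ε) * c) • P).PosDef := by
      rw [← sub_smul, show c - (1 - ε) * c = ε * c by ring]
      exact hP.smul (mul_pos hε hc0)
    exact hpd.eventually_posSemidef (hlim.sub_const (((1 - ε) * c) • P))
      fun j => by simp only [transpose_sub, transpose_smul, hPt, hQs _ (hpos _)]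
  have hup : ∀ᶠ j in atTop, (((1 + ε) * c) • P - Q (1 + (φ j : ℝ))).PosSemidef := by
    have hpd : (((1 + ε) * c) • P - c • P).PosDef := by
      rw [← sub_smul, show (1 + ε) * c - c = ε * c by ring]
      exact hP.smul (mul_pos hε hc0)
    exact hpd.eventually_posSemidef (hlim.const_sub (((1 + ε) * c) • P))
      fun j => by simp only [transpose_sub, transpose_smul, hPt, hQs _ (hpos _)]
  obtain ⟨j, hj1, hj2⟩ := (hlow.and hup).exists
  exact ⟨c, 1 + φ j, hc0, hpos _, fun t ht =>
    ⟨posSemidef_sub_const hS hW hP hP0 hQ (mul_pos (by linarith) hc0) (hpos _) ht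
      (hQs _ (hpos _)) hj1,
      posSemidef_const_sub hS hW hP hP0 hQ (mul_pos (by linarith) hc0) (hpos _) ht
      (hQs _ (hpos _)) hj2⟩⟩

end Convergence

/-! ### Order bounds and the Hilbert metric -/

section Hilbert

variable {n : ℕ} {X P : Matrix (Fin n) (Fin n) ℝ}

theorem hilbertm_le_hilbertM (hP : 0 < P.trace) :
    hilbertm (psdCone n) X P ≤ hilbertM (psdCone n) X P := by
  refine iSup₂_le fun a ha => le_iInf₂ fun b hb => ?_
  have h1 := (PosSemidef.add ha hb).trace_nonneg
  rw [show X - (a : ℝ) • P + ((b : ℝ) • P - X) = ((b : ℝ) - a) • P by module, trace_smul,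
    smul_eq_mul] at h1
  have h2 := nonneg_of_mul_nonneg_left h1 hP
  exact_mod_cast sub_nonneg.1 h2

/-- Two-sided bounds give m > 0 and M < ∞, which excludes degenerate quotients; m ≤ M then gives
nonnegativity. -/
theorem hilbertDist_mem_Icc (hP : 0 < P.trace) {a b : ℝ} (ha : 0 < a) (hb : 0 < b)
    (h1 : (X - a • P).PosSemidef) (h2 : (b • P - X).PosSemidef) :
    0 ≤ hilbertDist (psdCone n) X P ∧
      hilbertDist (psdCone n) X P ≤ ENNReal.log (ENNReal.ofReal b / ENNReal.ofReal a) := by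
  have hm : ENNReal.ofReal a ≤ hilbertm (psdCone n) X P :=
    le_iSup₂_of_le a.toNNReal (by rw [Real.coe_toNNReal a ha.le]; exact h1) le_rfl
  have hM : hilbertM (psdCone n) X P ≤ ENNReal.ofReal b :=
    iInf₂_le_of_le b.toNNReal (by rw [Real.coe_toNNReal b hb.le]; exact h2) le_rfl
  have hmM := hilbertm_le_hilbertM (X := X) hP
  have hm0 : hilbertm (psdCone n) X P ≠ 0 :=
    ((ENNReal.ofReal_pos.2 ha).trans_le hm).ne'
  have hM0 : hilbertM (psdCone n) X P ≠ ⊤ := (hM.trans_lt ENNReal.ofReal_lt_top).ne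
  refine ⟨?_, ENNReal.log_le_log (ENNReal.div_le_div hM hm)⟩
  rw [hilbertDist, ← ENNReal.log_one]
  refine ENNReal.log_le_log ?_
  rw [ENNReal.le_div_iff_mul_le (.inl hm0) (.inl (hmM.trans_lt hM0.lt_top).ne), one_mul]
  exact hmM

/-- The metric is projective: c cancels from the ratio of the bounds, leaving (1 + ε) / (1 - ε) → 1,
even if c depends on ε. -/
theorem tendsto_hilbertDist {Q : ℝ → Matrix (Fin n) (Fin n) ℝ} (hP : 0 < P.trace)
    (h : ∀ ε : ℝ, 0 < ε → ε < 1 → ∃ c t₀ : ℝ, 0 < c ∧ 0 ≤ t₀ ∧ ∀ t, t₀ ≤ t →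
      (Q t - ((1 - ε) * c) • P).PosSemidef ∧ (((1 + ε) * c) • P - Q t).PosSemidef) :
    Tendsto (fun t => hilbertDist (psdCone n) (Q t) P) atTop (𝓝 0) := by
  have hlim : Tendsto (fun ε : ℝ => ENNReal.log (ENNReal.ofReal ((1 + ε) / (1 - ε)))) (𝓝[>] 0)
      (𝓝 0) := by
    have h1 : Tendsto (fun ε : ℝ => (1 + ε) / (1 - ε)) (𝓝 0) (𝓝 ((1 + 0) / (1 - 0))) :=
      ((continuous_const.add continuous_id).tendsto 0).div
        ((continuous_const.sub continuous_id).tendsto 0) (by norm_num)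
    have h2 := (ENNReal.continuous_log.tendsto _).comp
      ((ENNReal.continuous_ofReal.tendsto _).comp h1)
    simp only [add_zero, sub_zero, div_one, ENNReal.ofReal_one, ENNReal.log_one] at h2
    exact h2.mono_left nhdsWithin_le_nhds
  have hkey : ∀ ε : ℝ, 0 < ε → ε < 1 → ∀ᶠ t in atTop, 0 ≤ hilbertDist (psdCone n) (Q t) P ∧
      hilbertDist (psdCone n) (Q t) P ≤ ENNReal.log (ENNReal.ofReal ((1 + ε) / (1 - ε))) := by
    intro ε hε hε1
    obtain ⟨c, t₀, hc, -, ht⟩ := h ε hε hε1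
    filter_upwards [eventually_ge_atTop t₀] with t htt
    have ha : 0 < (1 - ε) * c := mul_pos (by linarith) hc
    have := hilbertDist_mem_Icc hP ha (mul_pos (by linarith) hc) (ht t htt).1 (ht t htt).2
    rwa [← ENNReal.ofReal_div_of_pos ha, mul_div_mul_right _ _ hc.ne'] at this
  refine tendsto_order.2 ⟨fun y hy => ?_, fun y hy => ?_⟩
  · filter_upwards [hkey (1 / 2) (by norm_num) (by norm_num)] with t ht
    exact hy.trans_le ht.1
  · obtain ⟨ε, hεy, hε⟩ := ((hlim.eventually_lt_const hy).and
      (Ioo_mem_nhdsGT (zero_lt_one' ℝ))).exists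
    filter_upwards [hkey ε hε.1 hε.2] with t ht
    exact ht.2.trans_lt hεy

end Hilbert

/-! ### Translation from the control system -/

section ControlSystem

theorem mulVec_eq_zero_of_rank_eq {ι κ : Type*} [Fintype ι] [Fintype κ] {M : Matrix κ ι ℝ}
    (hM : M.rank = Fintype.card ι) {v : ι → ℝ} (hv : M *ᵥ v = 0) : v = 0 := by
  have h1 := LinearMap.finrank_range_add_finrank_ker M.mulVecLin
  rw [show Module.finrank ℝ (LinearMap.range M.mulVecLin) = Fintype.card ι from hM,
    Module.finrank_fintype_fun_eq_card] at h1
  have h2 : LinearMap.ker M.mulVecLin = ⊥ := Submodule.finrank_eq_zero.1 (by omega)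
  exact LinearMap.ker_eq_bot'.1 h2 v hv

variable {n m p : ℕ} {A : Matrix (Fin n) (Fin n) ℝ} {B : Matrix (Fin n) (Fin m) ℝ}
  {C : Matrix (Fin p) (Fin n) ℝ} {R : Matrix (Fin m) (Fin m) ℝ}

/-- CᵀC and C have the same kernel, and a matrix of full column rank has trivial kernel. -/
theorem IsObservable.eq_zero (h : IsObservable A C) (v : Fin n → ℝ)
    (hv : ∀ k : ℕ, (Cᵀ * C) *ᵥ (A ^ k *ᵥ v) = 0) : v = 0 := by
  refine mulVec_eq_zero_of_rank_eq (M := observabilityMatrix A C)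
    (by rw [Fintype.card_fin]; exact h) ?_
  ext ⟨k, i⟩
  have h1 : C *ᵥ (A ^ (k : ℕ) *ᵥ v) = 0 := by
    rw [← conjTranspose_mul_self_mulVec_eq_zero, conjTranspose_eq_transpose_of_trivial]
    exact hv k
  rw [mulVec_mulVec] at h1
  exact congrFun h1 i

/-- Since R⁻¹ is positive definite, B R⁻¹ Bᵀ u = 0 forces Bᵀu = 0; then transpose the
controllability matrix. -/
theorem IsControllable.eq_zero (h : IsControllable A B) (hR : R.PosDef) (v : Fin n → ℝ)
    (hv : ∀ k : ℕ, (B * R⁻¹ * Bᵀ) *ᵥ (Aᵀ ^ k *ᵥ v) = 0) : v = 0 := by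
  refine mulVec_eq_zero_of_rank_eq (M := (controllabilityMatrix A B)ᵀ)
    (by rw [Fintype.card_fin, rank_transpose]; exact h) ?_
  ext ⟨k, i⟩
  have h1 : Bᵀ *ᵥ (Aᵀ ^ (k : ℕ) *ᵥ v) = 0 := by
    by_contra hne
    have h2 := hR.inv.quad_pos hne
    have h3 := congrArg ((Aᵀ ^ (k : ℕ) *ᵥ v) ⬝ᵥ ·) (hv k)
    simp only [← mulVec_mulVec, dotProduct_zero] at h3
    rw [dotProduct_mulVec, ← mulVec_transpose] at h3
    exact h2.ne' h3
  rw [mulVec_mulVec, ← transpose_pow, ← transpose_mul] at h1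
  exact congrFun h1 i

theorem posSemidef_gain (hR : R.PosDef) : (B * R⁻¹ * Bᵀ).PosSemidef := by
  simpa [conjTranspose_eq_transpose_of_trivial] using
    hR.inv.posSemidef.mul_mul_conjTranspose_same B

theorem posSemidef_transpose_mul_self (C : Matrix (Fin p) (Fin n) ℝ) : (Cᵀ * C).PosSemidef := by
  simpa [conjTranspose_eq_transpose_of_trivial] using posSemidef_conjTranspose_mul_self C

theorem solvesCARE_iff {P : Matrix (Fin n) (Fin n) ℝ} :
    SolvesCARE A B C R P ↔ riccati A (B * R⁻¹ * Bᵀ) (Cᵀ * C) P = 0 := by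
  simp only [SolvesCARE, riccati, Matrix.mul_assoc]

theorem homogenizedField_eq (α : ℝ) (P : Matrix (Fin n) (Fin n) ℝ) :
    homogenizedField A B C R α P = homField A (B * R⁻¹ * Bᵀ) (Cᵀ * C) α P := by
  simp only [homogenizedField, homField, Matrix.mul_assoc]

theorem isTrajectory_of_solvesOn {α : ℝ} {Q : ℝ → Matrix (Fin n) (Fin n) ℝ}
    (h : ∀ T, SolvesOn A (B * R⁻¹ * Bᵀ) (Cᵀ * C) α Q T) : IsTrajectory A B C R α (Q 0) Q where
  initial := rfl
  trace_ne_zero t ht := ((h t).trace_pos t ⟨ht, le_rfl⟩).ne'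
  hasDeriv t ht i j := by
    rw [homogenizedField_eq]
    refine ((h (t + 1)).hasDeriv_entry t ⟨ht, by linarith⟩ i j).mono_of_mem_nhdsWithin ?_
    rw [mem_nhdsWithin]
    exact ⟨Set.Iio (t + 1), isOpen_Iio, lt_add_one t, fun s hs => ⟨hs.2, le_of_lt hs.1⟩⟩

/-- The trace is continuous, never zero and initially positive, so it stays positive. -/
theorem IsTrajectory.solvesOn {α : ℝ} {P₀ : Matrix (Fin n) (Fin n) ℝ}
    {Q : ℝ → Matrix (Fin n) (Fin n) ℝ} (h : IsTrajectory A B C R α P₀ Q) (h0 : 0 < P₀.trace)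
    (T : ℝ) : SolvesOn A (B * R⁻¹ * Bᵀ) (Cᵀ * C) α Q T where
  trace_pos t ht := by
    by_contra! hneg
    have hc : ContinuousOn (fun s => (Q s).trace) (Set.Icc 0 t) :=
      continuousOn_finsetSum _ fun i _ s hs =>
        (h.hasDeriv s hs.1 i i).continuousWithinAt.mono fun r hr => hr.1
    obtain ⟨s, hs, hs0⟩ := intermediate_value_Icc' ht.1 hc ⟨hneg, by rw [h.initial]; exact h0.le⟩
    exact h.trace_ne_zero s hs.1 hs0
  hasDeriv t ht := by
    rw [← homogenizedField_eq]
    exact hasDerivWithinAt_matrix_iff.2 fun i j =>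
      (h.hasDeriv t ht.1 i j).mono fun s hs => hs.1

end ControlSystem

theorem fact4 {n m p : ℕ} (A : Matrix (Fin n) (Fin n) ℝ) (B : Matrix (Fin n) (Fin m) ℝ)
    (C : Matrix (Fin p) (Fin n) ℝ) (R : Matrix (Fin m) (Fin m) ℝ) (hR : R.PosDef)
    (hAB : IsControllable A B) (hAC : IsObservable A C) :
    (∃! P : Matrix (Fin n) (Fin n) ℝ, P.PosDef ∧ SolvesCARE A B C R P) ∧
    ∀ P : Matrix (Fin n) (Fin n) ℝ, P.PosDef → SolvesCARE A B C R P →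
      ∃ α : ℝ, 0 < α ∧
        -- the ray of `P` consists of equilibria, and it is the only eigenray in the cone
        homogenizedField A B C R α P = 0 ∧
        (∀ X ∈ psdCone n, X ≠ 0 → ∀ μ : ℝ, homogenizedField A B C R α X = μ • X →
          μ = 0 ∧ P = (α * X.trace)⁻¹ • X) ∧
        -- every initial value in the cone without `0` has exactly one trajectory, and all
        -- trajectories stay in the cone, are positive definite at positive times and converge
        ∀ P₀ ∈ psdCone n, P₀ ≠ 0 →
          (∃ Q : ℝ → Matrix (Fin n) (Fin n) ℝ, IsTrajectory A B C R α P₀ Q) ∧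
          (∀ Q Q' : ℝ → Matrix (Fin n) (Fin n) ℝ, IsTrajectory A B C R α P₀ Q →
            IsTrajectory A B C R α P₀ Q' → ∀ t : ℝ, 0 ≤ t → Q t = Q' t) ∧
          ∀ Q : ℝ → Matrix (Fin n) (Fin n) ℝ, IsTrajectory A B C R α P₀ Q →
            (∀ t : ℝ, 0 ≤ t → Q t ∈ psdCone n ∧ Q t ≠ 0) ∧
            (∀ t : ℝ, 0 < t → (Q t).PosDef) ∧
            Tendsto (fun t : ℝ => hilbertDist (psdCone n) (Q t) P) atTop (𝓝 0) := by
  have hS : (B * R⁻¹ * Bᵀ).PosSemidef := posSemidef_gain hR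
  have hW := posSemidef_transpose_mul_self C
  have hobs := hAC.eq_zero
  refine ⟨?_, fun P hP hPc => ?_⟩
  · obtain ⟨P, hP, hP0⟩ := exists_riccati_eq_zero (hAB.eq_zero hR) hobs hS hW
    exact ⟨P, ⟨hP, solvesCARE_iff.2 hP0⟩, fun P' hP' =>
      riccati_eq_zero_unique hobs hS hW hP'.1 hP (solvesCARE_iff.1 hP'.2) hP0⟩
  cases isEmpty_or_nonempty (Fin n)
  -- For n = 0 there is no nonzero matrix, and any α > 0 will do.
  · exact ⟨1, one_pos, Subsingleton.elim _ _, fun X _ hX => absurd (Subsingleton.elim X 0) hX,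
      fun P₀ _ h => absurd (Subsingleton.elim P₀ 0) h⟩
  have htP := hP.trace_pos'
  have hα : 0 < 1 / P.trace := one_div_pos.2 htP
  have hP0 : homField A (B * R⁻¹ * Bᵀ) (Cᵀ * C) (1 / P.trace) P = 0 := by
    rw [homField_eq_riccati htP.ne' rfl, solvesCARE_iff.1 hPc, smul_zero]
  refine ⟨1 / P.trace, hα, by rw [homogenizedField_eq, hP0], fun X hX hX0 μ hμ => ?_,
    fun P₀ hP₀ hP₀0 => ?_⟩
  · rw [homogenizedField_eq] at hμ
    obtain ⟨h1, c, hc, rfl⟩ := homField_eigenray hα hobs hS hW hP hP0 hX hX0 hμ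
    refine ⟨h1, ?_⟩
    -- With α = 1 / tr P and X = cP one has α tr X = c.
    rw [trace_smul, smul_smul, smul_eq_mul,
      show (1 / P.trace * (c * P.trace))⁻¹ * c = 1 by field_simp, one_smul]
  have hP₀ps : P₀.PosSemidef := hP₀
  have hP₀t := hP₀ps.trace_pos hP₀0
  refine ⟨?_, fun Q Q' hQ hQ' t ht => ?_, fun Q hQ => ?_⟩
  · obtain ⟨Q, hQ0, hQ⟩ := exists_solvesOn (A := A) (1 / P.trace) hS hW hP₀ps hP₀0
    exact ⟨Q, hQ0 ▸ isTrajectory_of_solvesOn hQ⟩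
  · exact (hQ.solvesOn hP₀t t).eqOn (hQ'.solvesOn hP₀t t) (hQ.initial.trans hQ'.initial.symm)
      ⟨ht, le_rfl⟩
  · have hsol := hQ.solvesOn hP₀t
    have hQ0 : (Q 0).PosSemidef := hQ.initial ▸ hP₀ps
    refine ⟨fun t ht => ⟨(hsol t).posSemidef hS hW hQ0 t ⟨ht, le_rfl⟩, fun h0 => ?_⟩,
      fun t ht => (hsol t).posDef hα hobs hS hW hQ0 ht,
      tendsto_hilbertDist htP fun ε hε hε1 =>
        exists_orderInterval_of_solvesOn hα hobs hS hW hP hP0 hsol hQ0 hε hε1⟩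
    exact hQ.trace_ne_zero t ht (by rw [h0, trace_zero])
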